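/- For complex $a$, $q$ and integers $n \ge 0$ let $(a;q)_n = \prod_{j=0}^{n-1}(1-aq^j)$ and $(a_1,\dots,a_m;q)_n = (a_1;q)_n\cdots(a_m;q)_n$, and let $\psi(q) = \sum_{n=0}^\infty q^{n(n+1)/2}$ for $|q|<1$. Let $q$ and $\rho_1$ be complex numbers with $0<|q|<1$ and $|\rho_1|>1$, and let $i=\sqrt{-1}$. Then all the series below converge absolutely, and $$\begin{aligned} \psi^2(q^4) &= \frac{i}{2q} \left(\sum_{n=1}^{\infty} \frac{(1+iq^{4n-1})(-i/q, -i/q; q^2)_n (q^2; q^2)_{2n-1} (-iq)^n}{(1+i/q)(q^2, q^2; q^2)_n (-1; q^2)_{2n}} - \sum_{n=1}^{\infty} \frac{(1-iq^{4n-1})(i/q, i/q; q^2)_n (q^2; q^2)_{2n-1} (iq)^n}{(1-i/q)(q^2, q^2; q^2)_n (-1; q^2)_{2n}} \right)\\ &= \frac{1}{2iq} \left(\sum_{n=1}^{\infty} \frac{(i\rho_1 q; q^2)_n (-1)^n}{(-iq/\rho_1; q^2)_n (1-q^{2n}) \rho_1^n} - \sum_{n=1}^{\infty} \frac{(-i\rho_1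 q; q^2)_n (-1)^n}{(iq/\rho_1; q^2)_n (1-q^{2n}) \rho_1^n} \right. \\ &\qquad + \sum_{n=1}^{\infty} \frac{(1-iq^{4n-1})(i/q, \rho_1; q^2)_n (q^2; q^2)_{2n-1} (-1)^n}{(1-i/q)(iq/\rho_1, q^2; q^2)_n (-1; q^2)_{2n} \rho_1^n} \\ &\qquad \left. - \sum_{n=1}^{\infty} \frac{(1+iq^{4n-1})(-i/q, \rho_1; q^2)_n (q^2; q^2)_{2n-1} (-1)^n}{(1+i/q)(-iq/\rho_1, q^2; q^2)_n (-1; q^2)_{2n} \rho_1^n} \right)\\ &= \sum_{n=0}^{\infty} \frac{(-1)^n q^{4n^2+4n}}{1-q^{4n+2}} + \frac{1}{2iq} \left(\sum_{n=1}^{\infty} \frac{(1-iq^{4n-1})(i/q; q^2)_n (q^2; q^2)_{2n-1} q^{n^2-n}}{(1-i/q)(q^2; q^2)_n (-1; q^2)_{2n}} - \sum_{n=1}^{\infty} \frac{(1+iq^{4n-1})(-i/q; q^2)_n (q^2; q^2)_{2n-1} q^{n^2-n}}{(1+i/q)(q^2; q^2)_n (-1; q^2)_{2n}} \right). \end{aligned}$$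 -/

import Mathlib

/-- The finite `q`-shifted factorial `(a; q)_n = ∏_{j=0}^{n-1} (1 - a q^j)`. A symbol with several
parameters `(a₁, …, aₘ; q)_n` is the product of the `(aⱼ; q)_n`. -/
def qPoch (a q : ℂ) (n : ℕ) : ℂ :=
  ∏ j ∈ Finset.range n, (1 - a * q ^ j)

/-- Ramanujan's theta function `ψ(q) = ∑_{n ≥ 0} q^{n(n+1)/2}`, for `|q| < 1`. -/
noncomputable def ramanujanPsi (q : ℂ) : ℂ :=
  ∑' n : ℕ, q ^ (n * (n + 1) / 2)

open Filter Topology Finset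

/-!
Write the parameter `ρ₁` as `1 / x`, so that its limit at infinity is `x = 0`. By the terminating
`₆φ₅` sum, `(1 / (a x); p)_n xⁿ / (a p x; p)_n` expands in the well-poised quotients
`(1 / x; p)_k x^k / (a p x; p)_k`. Multiplying by `(a² p)ⁿ / (1 - pⁿ)` and summing over `n`, the
`q`-Gauss sum evaluates the coefficient of each quotient with `k ≥ 1`, while `k = 0` contributes a
derivative of the `q`-Gauss sum, which is a difference of Lambert series. This needs `|a² p| < 1`,
but for `|x| < 1` everything is continuous in `a` up to the boundary points with `a² p ≠ 1`.

The theorem is the case `p = q²`, `a = ± i / q`, where `a² p = -1`. The difference of the two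
Lambert series is `2 i q ∑ q^{2j} / (1 + q^{4j+2})`, and Clausen's transformation, Gauss's product
and a nonterminating `₆φ₅` sum identify the last sum with `ψ(q⁴)²`. The three displayed forms are
`x = a⁻¹`, `x = 1 / ρ₁` and `x = 0`; in the last one only the terms of odd index survive in the
difference of the two left-hand sides.
-/

section qPoch

variable {c p : ℂ}

@[simp]
lemma qPoch_zero (c p : ℂ) : qPoch c p 0 = 1 := Finset.prod_range_zero _

lemma qPoch_succ (c p : ℂ) (n : ℕ) : qPoch c p (n + 1) = qPoch c p n * (1 - c * p ^ n) :=
  Finset.prod_range_succ _ _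

lemma qPoch_add (c p : ℂ) (m n : ℕ) :
    qPoch c p (m + n) = qPoch c p m * qPoch (c * p ^ m) p n := by
  simp only [qPoch, prod_range_add, pow_add, mul_assoc]

lemma qPoch_succ' (c p : ℂ) (n : ℕ) : qPoch c p (n + 1) = (1 - c) * qPoch (c * p) p n := by
  rw [add_comm n 1, qPoch_add, pow_one, qPoch_succ, qPoch_zero, one_mul, pow_zero, mul_one]

@[fun_prop]
lemma continuous_qPoch (p : ℂ) (n : ℕ) : Continuous fun c => qPoch c p n := by
  unfold qPoch
  fun_prop

lemma qPoch_ne_zero (hc : ∀ j : ℕ, c * p ^ j ≠ 1) (n : ℕ) : qPoch c p n ≠ 0 :=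
  prod_ne_zero_iff.2 fun j _ => sub_ne_zero.2 (hc j).symm

lemma mul_mul_pow_ne_one (hc : ∀ j : ℕ, c * p ^ j ≠ 1) (j : ℕ) : c * p * p ^ j ≠ 1 := by
  simpa only [pow_succ', ← mul_assoc] using hc (j + 1)

lemma mul_pow_ne_one_of_norm_lt_one (hp : ‖p‖ < 1) (hc : ‖c‖ < 1) (j : ℕ) : c * p ^ j ≠ 1 := by
  refine fun h => (mul_lt_one_of_nonneg_of_lt_one_left (norm_nonneg c) hc
    (pow_le_one₀ (n := j) (norm_nonneg p) hp.le)).ne ?_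
  rw [← norm_pow, ← norm_mul, h, norm_one]

lemma one_sub_pow_succ_ne_zero (hp : ‖p‖ < 1) (n : ℕ) : 1 - p ^ (n + 1) ≠ 0 :=
  sub_ne_zero.2 (by simpa only [pow_succ'] using (mul_pow_ne_one_of_norm_lt_one hp hp n).symm)

/-- The homogeneous `q`-shifted factorial `∏_{j<n} (x - b pʲ) = xⁿ (b / x; p)_n`. Summands with a
parameter `ρ` are written through `x = 1 / ρ`, so that the limit `ρ → ∞` is the value at `x = 0`. -/
def qPochHom (b x p : ℂ) (n : ℕ) : ℂ :=
  ∏ j ∈ range n, (x - b * p ^ j)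

@[simp]
lemma qPochHom_zero (b x p : ℂ) : qPochHom b x p 0 = 1 := Finset.prod_range_zero _

lemma qPochHom_succ (b x p : ℂ) (n : ℕ) :
    qPochHom b x p (n + 1) = qPochHom b x p n * (x - b * p ^ n) :=
  Finset.prod_range_succ _ _

lemma qPochHom_one_right (b p : ℂ) (n : ℕ) : qPochHom b 1 p n = qPoch b p n := rfl

@[fun_prop]
lemma continuous_qPochHom (b p : ℂ) (n : ℕ) : Continuous fun x => qPochHom b x p n := by
  unfold qPochHom
  fun_prop

lemma qPochHom_inv {ρ : ℂ} (hρ : ρ ≠ 0) (b p : ℂ) (n : ℕ) :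
    qPochHom b ρ⁻¹ p n = qPoch (b * ρ) p n / ρ ^ n := by
  have h := prod_mul_pow_card (s := range n) (f := fun j => ρ⁻¹ - b * p ^ j) (b := ρ)
  rw [card_range] at h
  rw [eq_div_iff (pow_ne_zero n hρ), qPochHom, h]
  exact prod_congr rfl fun j _ => by field_simp

lemma qPochHom_zero_right (b p : ℂ) (n : ℕ) :
    qPochHom b 0 (p ^ 2) n = (-b) ^ n * p ^ (n ^ 2 - n) := by
  have h : ∑ j ∈ range n, 2 * j = n ^ 2 - n := by
    rw [← mul_sum, mul_comm, sum_range_id_mul_two, Nat.mul_sub, mul_one, sq]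
  simp only [qPochHom, zero_sub, ← neg_mul, ← pow_mul]
  rw [prod_mul_distrib, prod_const, card_range, prod_pow_eq_pow_sum, h]

/-- The infinite `q`-shifted factorial `(c; p)_∞`, for `|p| < 1`. -/
noncomputable def qPochInf (c p : ℂ) : ℂ :=
  ∏' j : ℕ, (1 - c * p ^ j)

lemma summable_norm_neg_mul_pow (hp : ‖p‖ < 1) (c : ℂ) :
    Summable fun j : ℕ => ‖-(c * p ^ j)‖ := by
  simpa only [norm_neg, norm_mul, norm_pow] using
    (summable_geometric_of_lt_one (norm_nonneg p) hp).mul_left ‖c‖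

lemma tendsto_qPoch (hp : ‖p‖ < 1) (c : ℂ) :
    Tendsto (qPoch c p) atTop (𝓝 (qPochInf c p)) := by
  have := (multipliable_one_add_of_summable (summable_norm_neg_mul_pow hp c)).hasProd
  simp only [← sub_eq_add_neg] at this
  exact this.tendsto_prod_nat

lemma qPochInf_ne_zero (hp : ‖p‖ < 1) (hc : ∀ j : ℕ, c * p ^ j ≠ 1) : qPochInf c p ≠ 0 := by
  simpa only [← sub_eq_add_neg, qPochInf] using tprod_one_add_ne_zero_of_summable
    (fun j => by simpa only [← sub_eq_add_neg] using sub_ne_zero.2 (hc j).symm)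
    (summable_norm_neg_mul_pow hp c)

end qPoch

section bounds

variable {c p : ℂ}

lemma exists_forall_norm_le_of_tendsto {u : ℕ → ℂ} {l : ℂ} (hu : Tendsto u atTop (𝓝 l)) :
    ∃ C > 0, ∀ n, ‖u n‖ ≤ C := by
  simpa using (Metric.isBounded_range_of_tendsto u hu).exists_pos_norm_le

lemma hasSum_sub_succ_of_tendsto_zero {u : ℕ → ℂ} (hs : Summable fun n => u n - u (n + 1))
    (hu : Tendsto u atTop (𝓝 0)) : HasSum (fun n => u n - u (n + 1)) (u 0) := by
  rw [hs.hasSum_iff_tendsto_nat]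
  simpa only [sum_range_sub', sub_zero] using hu.const_sub (u 0)

lemma exists_norm_qPochHom_le (hp : ‖p‖ < 1) (R : ℝ) {s : ℝ} (hs : 0 < s) :
    ∃ C > 0, ∀ b x : ℂ, ‖b‖ ≤ R → ‖x‖ ≤ s → ∀ n, ‖qPochHom b x p n‖ ≤ C * s ^ n := by
  have hp' : ‖(‖p‖ : ℂ)‖ < 1 := by simpa using hp
  obtain ⟨C, hC, hC'⟩ := exists_forall_norm_le_of_tendsto (tendsto_qPoch hp' (-(R / s : ℝ)))
  refine ⟨C, hC, fun b x hb hx n => ?_⟩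
  have hR : 0 ≤ R := (norm_nonneg b).trans hb
  have factor (j : ℕ) : ‖x - b * p ^ j‖ ≤ ‖1 - (-(R / s : ℝ) : ℂ) * (‖p‖ : ℂ) ^ j‖ * s := by
    have : 1 - (-(R / s : ℝ) : ℂ) * (‖p‖ : ℂ) ^ j = ((1 + R / s * ‖p‖ ^ j : ℝ) : ℂ) := by
      push_cast; ring
    rw [this, Complex.norm_of_nonneg (by positivity)]
    calc ‖x - b * p ^ j‖ ≤ ‖x‖ + ‖b‖ * ‖p‖ ^ j := by simpa using norm_sub_le x (b * p ^ j)
      _ ≤ s + R * ‖p‖ ^ j := by gcongr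
      _ = (1 + R / s * ‖p‖ ^ j) * s := by field_simp
  calc ‖qPochHom b x p n‖ ≤ ∏ j ∈ range n, ‖1 - (-(R / s : ℝ) : ℂ) * (‖p‖ : ℂ) ^ j‖ * s := by
        rw [qPochHom, norm_prod]
        exact prod_le_prod (fun _ _ => norm_nonneg _) fun j _ => factor j
    _ = ‖qPoch (-(R / s : ℝ)) ‖p‖ n‖ * s ^ n := by
        rw [prod_mul_distrib, prod_const, card_range, qPoch, norm_prod]
    _ ≤ C * s ^ n := by gcongr; exact hC' n

lemma exists_norm_qPoch_le (hp : ‖p‖ < 1) (R : ℝ) :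
    ∃ C > 0, ∀ c : ℂ, ‖c‖ ≤ R → ∀ n, ‖qPoch c p n‖ ≤ C := by
  obtain ⟨C, hC, h⟩ := exists_norm_qPochHom_le hp R one_pos
  exact ⟨C, hC, fun c hc n => by
    simpa [qPochHom_one_right] using h c 1 hc norm_one.le n⟩

lemma exists_norm_qPoch_inv_le_of_norm_le (hp : ‖p‖ < 1) {r : ℝ} (hr : r < 1) :
    ∃ C > 0, ∀ c : ℂ, ‖c‖ ≤ r → ∀ n, ‖(qPoch c p n)⁻¹‖ ≤ C := by
  obtain hr0 | hr0 := lt_or_ge r 0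
  · exact ⟨1, one_pos, fun c hc => absurd (norm_nonneg c) (hc.trans_lt hr0).not_ge⟩
  have hp' : ‖(‖p‖ : ℂ)‖ < 1 := by simpa using hp
  have hr' : ‖(r : ℂ)‖ < 1 := by rwa [Complex.norm_of_nonneg hr0]
  have hne := mul_pow_ne_one_of_norm_lt_one hp' hr'
  obtain ⟨C, hC, hC'⟩ := exists_forall_norm_le_of_tendsto
    ((tendsto_qPoch hp' r).inv₀ (qPochInf_ne_zero hp' hne))
  refine ⟨C, hC, fun c hc n => le_trans ?_ (hC' n)⟩
  rw [norm_inv, norm_inv]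
  refine inv_anti₀ (norm_pos_iff.2 (qPoch_ne_zero hne n)) ?_
  simp only [qPoch, norm_prod]
  refine prod_le_prod (fun _ _ => norm_nonneg _) fun j _ => ?_
  have hj : r * ‖p‖ ^ j ≤ 1 := mul_le_one₀ hr.le (by positivity) (pow_le_one₀ (norm_nonneg p) hp.le)
  calc ‖1 - (r : ℂ) * (‖p‖ : ℂ) ^ j‖ = 1 - r * ‖p‖ ^ j := by
        rw [← Complex.norm_of_nonneg (sub_nonneg.2 hj)]; push_cast; rfl
    _ ≤ ‖(1 : ℂ)‖ - ‖c * p ^ j‖ := by rw [norm_one, norm_mul, norm_pow]; gcongr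
    _ ≤ ‖1 - c * p ^ j‖ := norm_sub_norm_le _ _

lemma exists_norm_one_sub_inv_le {K : Set ℂ} (hK : IsCompact K) (h1 : 1 ∉ K) :
    ∃ C > 0, ∀ c ∈ K, ‖(1 - c)⁻¹‖ ≤ C := by
  have hcont : ContinuousOn (fun c : ℂ => (1 - c)⁻¹) K :=
    (by fun_prop : ContinuousOn (fun c : ℂ => 1 - c) K).inv₀ fun c hc h0 =>
      h1 (sub_eq_zero.1 h0 ▸ hc)
  obtain ⟨C, hC⟩ := hK.exists_bound_of_continuousOn hcont
  exact ⟨max C 1, by positivity, fun c hc => (hC c hc).trans (le_max_left _ _)⟩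

lemma exists_norm_qPoch_inv_le (hp : ‖p‖ < 1) {K : Set ℂ} (hK : IsCompact K)
    (hne : ∀ c ∈ K, ∀ j : ℕ, c * p ^ j ≠ 1) :
    ∃ C > 0, ∀ c ∈ K, ∀ n, ‖(qPoch c p n)⁻¹‖ ≤ C := by
  obtain ⟨R, -, hKR⟩ := hK.isBounded.exists_pos_norm_le
  have hlim : Tendsto (fun N : ℕ => R * ‖p‖ ^ N) atTop (𝓝 0) := by
    simpa using (tendsto_pow_atTop_nhds_zero_of_lt_one (norm_nonneg p) hp).const_mul R
  obtain ⟨N, hN⟩ := (hlim.eventually_le_const (half_pos one_pos)).exists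
  replace hN : ∀ c ∈ K, ‖c * p ^ N‖ ≤ 1 / 2 := fun c hc => by
    rw [norm_mul, norm_pow]
    exact (mul_le_mul_of_nonneg_right (hKR c hc) (by positivity)).trans hN
  clear hlim hKR
  induction N generalizing K with
  | zero =>
    obtain ⟨C, hC, hC'⟩ := exists_norm_qPoch_inv_le_of_norm_le hp one_half_lt_one
    exact ⟨C, hC, fun c hc => hC' c (by simpa using hN c hc)⟩
  | succ N ih =>
    obtain ⟨C, hC, hC'⟩ := exists_norm_one_sub_inv_le hK fun h => by simpa using hne 1 h 0
    obtain ⟨D, -, hD'⟩ := ih (hK.image (continuous_mul_const p))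
      (Set.forall_mem_image.2 fun c hc => mul_mul_pow_ne_one (hne c hc))
      (Set.forall_mem_image.2 fun c hc => by simpa only [pow_succ', mul_assoc] using hN c hc)
    refine ⟨max 1 (C * D), lt_max_of_lt_left one_pos, fun c hc n => ?_⟩
    cases n with
    | zero => simp
    | succ n =>
      rw [qPoch_succ', mul_inv, norm_mul]
      refine le_max_of_le_right ?_
      gcongr
      exacts [hC' c hc, hD' _ (Set.mem_image_of_mem _ hc) n]

end bounds

section sixPhiFive

variable {a p w x y : ℂ}

/-- The very-well-poised factor `(1 - a p^{2k}) (a; p)_k / ((1 - a) (p; p)_k)`. -/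
noncomputable def veryWellPoised (a p : ℂ) (k : ℕ) : ℂ :=
  (1 - a * p ^ (2 * k)) * qPoch a p k / ((1 - a) * qPoch p p k)

/-- The quotient `(ρ; p)_k / ((a p / ρ; p)_k ρ^k)` belonging to a parameter `ρ = 1 / x` of a
well-poised series. -/
noncomputable def wellPoisedRatio (a p x : ℂ) (k : ℕ) : ℂ :=
  qPochHom 1 x p k / qPoch (a * p * x) p k

/-- The summand of the very-well-poised `₆φ₅` series with parameters `1 / x`, `1 / y`, `1 / w`. -/
noncomputable def sixPhiFiveTerm (a p x y w : ℂ) (k : ℕ) : ℂ :=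
  veryWellPoised a p k * wellPoisedRatio a p x k * wellPoisedRatio a p y k *
    wellPoisedRatio a p w k * (a * p) ^ k

/-- The common factor of the `₆φ₅` summands with parameters `1 / w` and `1 / (w p)`. -/
noncomputable def sixPhiFiveWeight (a p x y w : ℂ) (k : ℕ) : ℂ :=
  qPoch a p k / ((1 - a) * qPoch p p k) * wellPoisedRatio a p x k * wellPoisedRatio a p y k *
    wellPoisedRatio a p (w * p) k * a ^ k

lemma wellPoisedRatio_succ (hx : ∀ j : ℕ, a * p * x * p ^ j ≠ 1) (k : ℕ) :
    wellPoisedRatio a p x (k + 1) * (1 - a * x * p ^ (k + 1)) =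
      wellPoisedRatio a p x k * (x - p ^ k) := by
  rw [show 1 - a * x * p ^ (k + 1) = 1 - a * p * x * p ^ k by ring, wellPoisedRatio,
    qPochHom_succ, qPoch_succ, one_mul, mul_div_mul_comm, mul_assoc,
    div_mul_cancel₀ _ (sub_ne_zero.2 (hx k).symm), wellPoisedRatio]

lemma sixPhiFiveWeight_succ (hp : ∀ j : ℕ, p * p ^ j ≠ 1) (hx : ∀ j : ℕ, a * p * x * p ^ j ≠ 1)
    (hy : ∀ j : ℕ, a * p * y * p ^ j ≠ 1) (hw : ∀ j : ℕ, a * p * (w * p) * p ^ j ≠ 1) (k : ℕ) :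
    sixPhiFiveWeight a p x y w (k + 1) * ((1 - p ^ (k + 1)) * (1 - a * x * p ^ (k + 1)) *
        (1 - a * y * p ^ (k + 1)) * (1 - a * (w * p) * p ^ (k + 1))) =
      sixPhiFiveWeight a p x y w k *
        ((1 - a * p ^ k) * (x - p ^ k) * (y - p ^ k) * (a * (w * p - p ^ k))) := by
  have hpoch : qPoch a p (k + 1) / ((1 - a) * qPoch p p (k + 1)) * (1 - p ^ (k + 1)) =
      qPoch a p k / ((1 - a) * qPoch p p k) * (1 - a * p ^ k) := by
    have h : 1 - p ^ (k + 1) ≠ 0 := sub_ne_zero.2 (by simpa only [pow_succ'] using (hp k).symm)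
    rw [qPoch_succ, qPoch_succ, ← pow_succ', ← mul_assoc, mul_div_mul_comm, mul_assoc,
      div_mul_cancel₀ _ h]
  calc _ = qPoch a p (k + 1) / ((1 - a) * qPoch p p (k + 1)) * (1 - p ^ (k + 1)) *
        (wellPoisedRatio a p x (k + 1) * (1 - a * x * p ^ (k + 1))) *
        (wellPoisedRatio a p y (k + 1) * (1 - a * y * p ^ (k + 1))) *
        (wellPoisedRatio a p (w * p) (k + 1) * (1 - a * (w * p) * p ^ (k + 1))) * a ^ (k + 1) := by
        rw [sixPhiFiveWeight]; ring
    _ = _ := by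
        rw [hpoch, wellPoisedRatio_succ hx, wellPoisedRatio_succ hy, wellPoisedRatio_succ hw,
          sixPhiFiveWeight]
        ring

lemma sixPhiFiveTerm_mul_right (a p x y w : ℂ) (k : ℕ) :
    sixPhiFiveTerm a p x y (w * p) k =
      (1 - a * p ^ (2 * k)) * p ^ k * sixPhiFiveWeight a p x y w k := by
  simp only [sixPhiFiveTerm, sixPhiFiveWeight, veryWellPoised, mul_pow]
  ring

lemma mul_qPochHom_eq (p w : ℂ) (k : ℕ) :
    (w * p - 1) * p ^ k * qPochHom 1 w p k = (w * p - p ^ k) * qPochHom 1 (w * p) p k := by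
  induction k with
  | zero => simp
  | succ k ih =>
    rw [qPochHom_succ, qPochHom_succ]
    linear_combination (w - p ^ k) * p * ih

lemma mul_wellPoisedRatio_eq (hw : ∀ j : ℕ, a * p * w * p ^ j ≠ 1) (k : ℕ) :
    (w * p - 1) * (1 - a * (w * p)) * (p ^ k * wellPoisedRatio a p w k) =
      (w * p - p ^ k) * (1 - a * (w * p) * p ^ k) * wellPoisedRatio a p (w * p) k := by
  have hden : (1 - a * (w * p)) * qPoch (a * p * (w * p)) p k =
      qPoch (a * p * w) p k * (1 - a * (w * p) * p ^ k) := by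
    have h := (qPoch_succ' (a * p * w) p k).symm.trans (qPoch_succ _ _ _)
    rw [show a * p * (w * p) = a * p * w * p by ring, show a * (w * p) = a * p * w by ring, h]
  have h₁ := qPoch_ne_zero hw k
  have h₂ : qPoch (a * p * (w * p)) p k ≠ 0 := by
    rw [← mul_assoc]; exact qPoch_ne_zero (mul_mul_pow_ne_one hw) k
  rw [wellPoisedRatio, wellPoisedRatio, mul_div_assoc', mul_div_assoc', mul_div_assoc',
    div_eq_div_iff h₁ h₂]
  linear_combination (w * p - 1) * p ^ k * qPochHom 1 w p k * hden +
    qPoch (a * p * w) p k * (1 - a * (w * p) * p ^ k) * mul_qPochHom_eq p w k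

lemma mul_sixPhiFiveTerm_eq (hw : ∀ j : ℕ, a * p * w * p ^ j ≠ 1) (k : ℕ) :
    (w * p - 1) * (1 - a * (w * p)) * sixPhiFiveTerm a p x y w k =
      (1 - a * p ^ (2 * k)) * (w * p - p ^ k) * (1 - a * (w * p) * p ^ k) *
        sixPhiFiveWeight a p x y w k := by
  simp only [sixPhiFiveTerm, sixPhiFiveWeight, veryWellPoised, mul_pow]
  linear_combination (1 - a * p ^ (2 * k)) * qPoch a p k / ((1 - a) * qPoch p p k) *
    wellPoisedRatio a p x k * wellPoisedRatio a p y k * a ^ k * mul_wellPoisedRatio_eq hw k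

lemma sixPhiFiveTerm_contiguous (hp : ∀ j : ℕ, p * p ^ j ≠ 1)
    (hx : ∀ j : ℕ, a * p * x * p ^ j ≠ 1) (hy : ∀ j : ℕ, a * p * y * p ^ j ≠ 1)
    (hw : ∀ j : ℕ, a * p * w * p ^ j ≠ 1) (N : ℕ) :
    (w * p - 1) * ((1 - a * (w * p) * x) * (1 - a * (w * p) * y) *
        ∑ k ∈ range N, sixPhiFiveTerm a p x y (w * p) k -
      (1 - a * (w * p)) * (1 - a * (w * p) * x * y) *
        ∑ k ∈ range N, sixPhiFiveTerm a p x y w k) =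
      w * p * sixPhiFiveWeight a p x y w N * ((1 - p ^ N) * (1 - a * x * p ^ N) *
        (1 - a * y * p ^ N) * (1 - a * (w * p) * p ^ N)) := by
  induction N with
  | zero => simp
  | succ k ih =>
    rw [sum_range_succ, sum_range_succ]
    have hw' : ∀ j : ℕ, a * p * (w * p) * p ^ j ≠ 1 := by
      simpa only [mul_assoc] using mul_mul_pow_ne_one hw
    linear_combination ih - w * p * sixPhiFiveWeight_succ hp hx hy hw' k +
      (w * p - 1) * (1 - a * (w * p) * x) * (1 - a * (w * p) * y) *
        sixPhiFiveTerm_mul_right a p x y w k -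
      (1 - a * (w * p) * x * y) * mul_sixPhiFiveTerm_eq (x := x) (y := y) hw k

lemma qPochHom_one_pow_eq_zero {k n : ℕ} (h : n < k) (p : ℂ) : qPochHom 1 (p ^ n) p k = 0 :=
  prod_eq_zero (mem_range.2 h) (by ring)

theorem sum_sixPhiFiveTerm (hp : ∀ j : ℕ, p * p ^ j ≠ 1) (ha : ∀ j : ℕ, a * p ^ j ≠ 1)
    (hx : ∀ j : ℕ, a * p * x * p ^ j ≠ 1) (hy : ∀ j : ℕ, a * p * y * p ^ j ≠ 1)
    {n N : ℕ} (hN : n < N) :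
    ∑ k ∈ range N, sixPhiFiveTerm a p x y (p ^ n) k =
      qPoch (a * p) p n * qPoch (a * p * x * y) p n /
        (qPoch (a * p * x) p n * qPoch (a * p * y) p n) := by
  induction n with
  | zero =>
    have ha₀ : 1 - a ≠ 0 := sub_ne_zero.2 (by simpa using (ha 0).symm)
    rw [sum_eq_single_of_mem 0 (mem_range.2 hN) fun k _ hk => by
      rw [sixPhiFiveTerm, wellPoisedRatio, wellPoisedRatio, wellPoisedRatio,
        qPochHom_one_pow_eq_zero (Nat.pos_of_ne_zero hk)]; ring]
    simp [sixPhiFiveTerm, veryWellPoised, wellPoisedRatio, ha₀]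
  | succ n ih =>
    have hW : p ^ n * p - 1 ≠ 0 := sub_ne_zero.2 (by simpa only [mul_comm] using hp n)
    have hcont := sixPhiFiveTerm_contiguous hp hx hy (w := p ^ n)
      (fun j => by
        have := ha (n + j + 1)
        rwa [show a * p ^ (n + j + 1) = a * p * p ^ n * p ^ j by ring] at this) N
    have hweight : sixPhiFiveWeight a p x y (p ^ n) N = 0 := by
      rw [sixPhiFiveWeight, wellPoisedRatio, wellPoisedRatio, wellPoisedRatio, ← pow_succ,
        qPochHom_one_pow_eq_zero hN]
      ring
    rw [hweight, mul_zero, zero_mul, mul_eq_zero, or_iff_right hW, sub_eq_zero,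
      ih (by lia), ← pow_succ] at hcont
    have hx' : 1 - a * p * x * p ^ n ≠ 0 := sub_ne_zero.2 (hx n).symm
    have hy' : 1 - a * p * y * p ^ n ≠ 0 := sub_ne_zero.2 (hy n).symm
    have hX := qPoch_ne_zero hx n
    have hY := qPoch_ne_zero hy n
    rw [show 1 - a * p ^ (n + 1) * x = 1 - a * p * x * p ^ n by ring,
      show 1 - a * p ^ (n + 1) * y = 1 - a * p * y * p ^ n by ring] at hcont
    simp only [qPoch_succ]
    generalize 1 - a * p * x * p ^ n = d₁ at *
    generalize 1 - a * p * y * p ^ n = d₂ at *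
    rw [← mul_right_inj' (mul_ne_zero hx' hy'), hcont]
    field_simp
    ring

end sixPhiFive

section sixPhiFiveLimit

variable {a p x y : ℂ}

lemma exists_norm_wellPoisedRatio_le (hp : ‖p‖ < 1) {K : Set ℂ} (hK : IsCompact K)
    (hne : ∀ c ∈ K, ∀ j : ℕ, c * p ^ j ≠ 1) {s : ℝ} (hs : 0 < s) :
    ∃ C > 0, ∀ a x : ℂ, a * p * x ∈ K → ‖x‖ ≤ s → ∀ k, ‖wellPoisedRatio a p x k‖ ≤ C * s ^ k := by
  obtain ⟨C, hC, hC'⟩ := exists_norm_qPochHom_le hp 1 hs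
  obtain ⟨D, hD, hD'⟩ := exists_norm_qPoch_inv_le hp hK hne
  refine ⟨C * D, by positivity, fun a x hax hx k => ?_⟩
  calc ‖wellPoisedRatio a p x k‖ = ‖qPochHom 1 x p k‖ * ‖(qPoch (a * p * x) p k)⁻¹‖ := by
        rw [wellPoisedRatio, div_eq_mul_inv, norm_mul]
    _ ≤ C * s ^ k * D := by gcongr; exacts [hC' 1 x norm_one.le hx k, hD' _ hax k]
    _ = C * D * s ^ k := by ring

lemma exists_norm_veryWellPoised_le (hp : ‖p‖ < 1) {K : Set ℂ} (hK : IsCompact K) (h1 : 1 ∉ K) :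
    ∃ C > 0, ∀ a ∈ K, ∀ k, ‖veryWellPoised a p k‖ ≤ C := by
  obtain ⟨R, hR, hKR⟩ := hK.isBounded.exists_pos_norm_le
  obtain ⟨B, hB, hB'⟩ := exists_norm_qPoch_le hp R
  obtain ⟨C, hC, hC'⟩ := exists_norm_one_sub_inv_le hK h1
  obtain ⟨D, hD, hD'⟩ := exists_norm_qPoch_inv_le_of_norm_le hp hp
  refine ⟨(1 + R) * B * (C * D), by positivity, fun a ha k => ?_⟩
  have hnum : ‖1 - a * p ^ (2 * k)‖ ≤ 1 + R := by
    calc ‖1 - a * p ^ (2 * k)‖ ≤ 1 + ‖a‖ * ‖p‖ ^ (2 * k) := by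
          simpa using norm_sub_le 1 (a * p ^ (2 * k))
      _ ≤ 1 + R * 1 := by gcongr; exacts [hKR a ha, pow_le_one₀ (norm_nonneg p) hp.le]
      _ = 1 + R := by rw [mul_one]
  rw [veryWellPoised, div_eq_mul_inv, mul_inv, norm_mul, norm_mul, norm_mul]
  gcongr
  exacts [hB' a (hKR a ha) k, hC' a ha, hD' p le_rfl k]

lemma continuousAt_wellPoisedRatio (hx : ∀ j : ℕ, a * p * x * p ^ j ≠ 1) (k : ℕ) :
    ContinuousAt (fun x => wellPoisedRatio a p x k) x :=
  ContinuousAt.div (by fun_prop) (by fun_prop) (qPoch_ne_zero hx k)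

lemma exists_eventually_norm_sixPhiFiveTerm_le (hp : ‖p‖ < 1) (ha : ∀ j : ℕ, a * p ^ j ≠ 1)
    (hx : ∀ j : ℕ, a * p * x * p ^ j ≠ 1) (hy : ∀ j : ℕ, a * p * y * p ^ j ≠ 1) :
    ∃ C, ∀ᶠ n : ℕ in atTop, ∀ k, ‖sixPhiFiveTerm a p x y (p ^ n) k‖ ≤ C * (1 / 2) ^ k := by
  have h1a : (1 : ℂ) ∉ ({a} : Set ℂ) := fun h => ha 0 (by rw [← Set.mem_singleton_iff.1 h]; simp)
  obtain ⟨A, hA, hA'⟩ := exists_norm_veryWellPoised_le hp isCompact_singleton h1a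
  obtain ⟨X, hX, hX'⟩ := exists_norm_wellPoisedRatio_le hp (isCompact_singleton (x := a * p * x))
    (by simpa using hx) (by positivity : 0 < ‖x‖ + 1)
  obtain ⟨Y, hY, hY'⟩ := exists_norm_wellPoisedRatio_le hp (isCompact_singleton (x := a * p * y))
    (by simpa using hy) (by positivity : 0 < ‖y‖ + 1)
  set s : ℝ := (2 * ((‖x‖ + 1) * (‖y‖ + 1) * (‖a * p‖ + 1)))⁻¹ with hs_def
  have hs : 0 < s := by positivity
  obtain ⟨W, hW, hW'⟩ := exists_norm_wellPoisedRatio_le hp (isCompact_closedBall (0 : ℂ) (1 / 2))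
    (fun c hc => mul_pow_ne_one_of_norm_lt_one hp
      ((mem_closedBall_zero_iff.1 hc).trans_lt one_half_lt_one)) hs
  have hlim : Tendsto (fun n : ℕ => p ^ n) atTop (𝓝 0) :=
    tendsto_pow_atTop_nhds_zero_of_norm_lt_one hp
  have hsmall : ∀ᶠ n : ℕ in atTop, ‖p ^ n‖ ≤ s :=
    (by simpa using hlim.norm : Tendsto (fun n : ℕ => ‖p ^ n‖) atTop (𝓝 0)).eventually_le_const hs
  have hmem : ∀ᶠ n : ℕ in atTop, ‖a * p * p ^ n‖ ≤ 1 / 2 :=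
    (by simpa using (hlim.const_mul (a * p)).norm :
      Tendsto (fun n : ℕ => ‖a * p * p ^ n‖) atTop (𝓝 0)).eventually_le_const (by norm_num)
  refine ⟨A * X * Y * W, ?_⟩
  filter_upwards [hsmall, hmem] with n hn hn' k
  have hratio : (‖x‖ + 1) * (‖y‖ + 1) * s * (‖a * p‖ + 1) = 1 / 2 := by
    rw [hs_def]; field_simp
  simp only [sixPhiFiveTerm, norm_mul, norm_pow (a * p)]
  calc _ ≤ A * (X * (‖x‖ + 1) ^ k) * (Y * (‖y‖ + 1) ^ k) * (W * s ^ k) * (‖a * p‖ + 1) ^ k := by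
        rw [← norm_mul a p]
        gcongr
        · exact hA' a rfl k
        · exact hX' a x rfl (by linarith) k
        · exact hY' a y rfl (by linarith) k
        · exact hW' a _ (mem_closedBall_zero_iff.2 hn') hn k
        · linarith
    _ = A * X * Y * W * ((‖x‖ + 1) * (‖y‖ + 1) * s * (‖a * p‖ + 1)) ^ k := by
        simp only [mul_pow]; ring
    _ = A * X * Y * W * (1 / 2) ^ k := by rw [hratio]

theorem hasSum_sixPhiFiveTerm_zero (hp : ‖p‖ < 1) (ha : ∀ j : ℕ, a * p ^ j ≠ 1)
    (hx : ∀ j : ℕ, a * p * x * p ^ j ≠ 1) (hy : ∀ j : ℕ, a * p * y * p ^ j ≠ 1) :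
    HasSum (sixPhiFiveTerm a p x y 0)
      (qPochInf (a * p) p * qPochInf (a * p * x * y) p /
        (qPochInf (a * p * x) p * qPochInf (a * p * y) p)) := by
  obtain ⟨C, hC⟩ := exists_eventually_norm_sixPhiFiveTerm_le hp ha hx hy
  have hgeom : Summable fun k : ℕ => C * (1 / 2 : ℝ) ^ k := summable_geometric_two.mul_left C
  have hterm (k : ℕ) : Tendsto (fun n : ℕ => sixPhiFiveTerm a p x y (p ^ n) k) atTop
      (𝓝 (sixPhiFiveTerm a p x y 0 k)) := by
    have hw := (continuousAt_wellPoisedRatio (a := a) (p := p) (x := 0) (by simp) k).tendsto.comp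
      (tendsto_pow_atTop_nhds_zero_of_norm_lt_one hp)
    exact (hw.const_mul _).mul_const _
  have hsum : Tendsto (fun n : ℕ => ∑' k, sixPhiFiveTerm a p x y (p ^ n) k) atTop
      (𝓝 (∑' k, sixPhiFiveTerm a p x y 0 k)) :=
    tendsto_tsum_of_dominated_convergence hgeom hterm hC
  have hprod : Tendsto (fun n : ℕ => ∑' k, sixPhiFiveTerm a p x y (p ^ n) k) atTop
      (𝓝 (qPochInf (a * p) p * qPochInf (a * p * x * y) p /
        (qPochInf (a * p * x) p * qPochInf (a * p * y) p))) := by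
    refine (((tendsto_qPoch hp _).mul (tendsto_qPoch hp _)).div
      ((tendsto_qPoch hp _).mul (tendsto_qPoch hp _))
      (mul_ne_zero (qPochInf_ne_zero hp hx) (qPochInf_ne_zero hp hy))).congr fun n => ?_
    rw [tsum_eq_sum (s := range (n + 1)) fun k hk => by
      rw [sixPhiFiveTerm, wellPoisedRatio, wellPoisedRatio, wellPoisedRatio,
        qPochHom_one_pow_eq_zero (by simpa using hk)]; ring]
    exact (sum_sixPhiFiveTerm (mul_pow_ne_one_of_norm_lt_one hp hp) ha hx hy n.lt_succ_self).symm
  have hsummable : Summable (sixPhiFiveTerm a p x y 0) :=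
    .of_norm_bounded hgeom fun k =>
      le_of_tendsto (hterm k).norm (hC.mono fun n hn => hn k)
  rw [← tendsto_nhds_unique hsum hprod]
  exact hsummable.hasSum

end sixPhiFiveLimit

section theta

variable {x : ℂ}

lemma norm_sq_lt_one (hx : ‖x‖ < 1) : ‖x ^ 2‖ < 1 := by
  rw [norm_pow]; exact pow_lt_one₀ (norm_nonneg x) hx two_ne_zero

lemma qPochInf_eq_mul {p : ℂ} (hp : ‖p‖ < 1) (c : ℂ) :
    qPochInf c p = (1 - c) * qPochInf (c * p) p := by
  refine tendsto_nhds_unique ((tendsto_add_atTop_iff_nat 1).2 (tendsto_qPoch hp c)) ?_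
  simpa only [qPoch_succ'] using (tendsto_qPoch hp (c * p)).const_mul (1 - c)

@[simp]
lemma qPochInf_zero_left (p : ℂ) : qPochInf 0 p = 1 := by simp [qPochInf]

lemma veryWellPoised_sq (hx : ‖x‖ < 1) (k : ℕ) :
    veryWellPoised (x ^ 2) (x ^ 2) k =
      (1 - x ^ (2 * k + 1)) * (1 + x ^ (2 * k + 1)) / ((1 - x) * (1 + x)) := by
  have hx2 := norm_sq_lt_one hx
  rw [veryWellPoised, mul_div_mul_right _ _
    (qPoch_ne_zero (mul_pow_ne_one_of_norm_lt_one hx2 hx2) k)]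
  congr 1 <;> ring

lemma wellPoisedRatio_sq_inv (hx0 : x ≠ 0) (hx : ‖x‖ < 1) (k : ℕ) :
    wellPoisedRatio (x ^ 2) (x ^ 2) x⁻¹ k = (1 - x) / (x ^ k * (1 - x ^ (2 * k + 1))) := by
  have hnum : qPochHom 1 x⁻¹ (x ^ 2) k = qPoch x (x ^ 2) k / x ^ k := by
    rw [qPochHom_inv hx0, one_mul]
  have hden : (1 - x) * qPoch (x ^ 2 * x ^ 2 * x⁻¹) (x ^ 2) k =
      qPoch x (x ^ 2) k * (1 - x ^ (2 * k + 1)) := by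
    rw [show x ^ 2 * x ^ 2 * x⁻¹ = x * x ^ 2 by field_simp, ← qPoch_succ', qPoch_succ]
    ring
  have hne : qPoch (x ^ 2 * x ^ 2 * x⁻¹) (x ^ 2) k ≠ 0 := by
    refine right_ne_zero_of_mul (a := 1 - x) ?_
    rw [hden]
    exact mul_ne_zero (qPoch_ne_zero (mul_pow_ne_one_of_norm_lt_one (norm_sq_lt_one hx) hx) k)
      (one_sub_pow_succ_ne_zero hx _)
  rw [wellPoisedRatio, hnum, div_div, div_eq_div_iff (mul_ne_zero (pow_ne_zero k hx0) hne)
    (mul_ne_zero (pow_ne_zero k hx0) (one_sub_pow_succ_ne_zero hx _))]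
  linear_combination -x ^ k * hden

lemma wellPoisedRatio_zero_right (a p : ℂ) (k : ℕ) :
    wellPoisedRatio a (p ^ 2) 0 k = (-1) ^ k * p ^ (k ^ 2 - k) := by
  rw [wellPoisedRatio, qPochHom_zero_right, mul_zero, qPoch, prod_eq_one (by simp), div_one]

lemma pow_sq_sub_self_mul_pow (x : ℂ) (k : ℕ) : x ^ (k ^ 2 - k) * x ^ k = x ^ k ^ 2 := by
  rw [← pow_add, Nat.sub_add_cancel (Nat.le_self_pow two_ne_zero k)]

lemma summable_ramanujanPsi (hx : ‖x‖ < 1) : Summable fun t : ℕ => x ^ (t * (t + 1) / 2) := by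
  refine .of_norm_bounded (summable_geometric_of_lt_one (norm_nonneg x) hx) fun t => ?_
  rw [norm_pow]
  refine pow_le_pow_of_le_one (norm_nonneg _) hx.le ((Nat.le_div_iff_mul_le two_pos).2 ?_)
  nlinarith [Nat.le_mul_self t]

lemma hasSum_ramanujanPsi_even_odd (hx : ‖x‖ < 1) :
    HasSum (fun k : ℕ => x ^ (2 * k ^ 2 + k) * (1 + x ^ (2 * k + 1))) (ramanujanPsi x) := by
  have hs := summable_ramanujanPsi hx
  have hexp_even (k : ℕ) : 2 * k * (2 * k + 1) / 2 = 2 * k ^ 2 + k :=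
    Nat.div_eq_of_eq_mul_left two_pos (by ring)
  have hexp_odd (k : ℕ) : (2 * k + 1) * (2 * k + 1 + 1) / 2 = 2 * k ^ 2 + k + (2 * k + 1) :=
    Nat.div_eq_of_eq_mul_left two_pos (by ring)
  have heven : Summable fun k : ℕ => x ^ (2 * k ^ 2 + k) := by
    simpa only [Function.comp_def, hexp_even] using
      hs.comp_injective (mul_right_injective₀ two_ne_zero)
  have hodd : Summable fun k : ℕ => x ^ (2 * k ^ 2 + k + (2 * k + 1)) := by
    simpa only [Function.comp_def, hexp_odd] using
      hs.comp_injective (i := fun k : ℕ => 2 * k + 1) fun i j h => by simpa using h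
  have hpsi : ramanujanPsi x = _ := (HasSum.even_add_odd (f := fun t : ℕ => x ^ (t * (t + 1) / 2))
    (by simpa only [hexp_even] using heven.hasSum)
    (by simpa only [hexp_odd] using hodd.hasSum)).tsum_eq
  simpa only [hpsi, mul_add, mul_one, ← pow_add] using heven.hasSum.add hodd.hasSum

/-- Gauss's product for `ψ`. -/
theorem ramanujanPsi_eq_qPochInf_div (hx0 : x ≠ 0) (hx : ‖x‖ < 1) :
    ramanujanPsi x = qPochInf (x ^ 2) (x ^ 2) / qPochInf x (x ^ 2) := by
  have hx2 := norm_sq_lt_one hx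
  have hx1 : 1 - x ≠ 0 := by simpa using one_sub_pow_succ_ne_zero hx 0
  have hx1' : 1 + x ≠ 0 := by
    simpa using one_sub_pow_succ_ne_zero (p := -x) (by rwa [norm_neg]) 0
  have hx3 : x ^ 2 * x ^ 2 * x⁻¹ = x * x ^ 2 := by field_simp
  have hne : ∀ j : ℕ, x * (x ^ 2) ^ j ≠ 1 := mul_pow_ne_one_of_norm_lt_one hx2 hx
  have hsum := hasSum_sixPhiFiveTerm_zero (a := x ^ 2) (x := 0) (y := x⁻¹) hx2
    (mul_pow_ne_one_of_norm_lt_one hx2 hx2) (by simp) (by rw [hx3]; exact mul_mul_pow_ne_one hne)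
  have hterm (k : ℕ) : (1 + x) * sixPhiFiveTerm (x ^ 2) (x ^ 2) 0 x⁻¹ 0 k =
      x ^ (2 * k ^ 2 + k) * (1 + x ^ (2 * k + 1)) := by
    have hk : 1 - x ^ (2 * k + 1) ≠ 0 := one_sub_pow_succ_ne_zero hx _
    have hexp : x ^ (2 * k ^ 2 + k) = (x ^ (k ^ 2 - k) * x ^ k) ^ 2 * x ^ k := by
      rw [pow_sq_sub_self_mul_pow]; ring
    rw [sixPhiFiveTerm, veryWellPoised_sq hx, wellPoisedRatio_sq_inv hx0 hx,
      wellPoisedRatio_zero_right, hexp]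
    generalize 1 - x ^ (2 * k + 1) = d at *
    field_simp
    rw [← pow_mul, mul_comm k 2, pow_mul, neg_one_sq, one_pow]
    ring
  have hpsi := (hasSum_ramanujanPsi_even_odd hx).unique
    (by simpa only [hterm] using hsum.mul_left (1 + x))
  rw [hpsi, hx3, qPochInf_eq_mul hx2 x, qPochInf_eq_mul hx2 (x ^ 2), mul_zero, zero_mul,
    qPochInf_zero_left]
  have := qPochInf_ne_zero hx2 (mul_mul_pow_ne_one hne)
  field_simp
  ring

lemma hasSum_ramanujanPsi_sq_lambert (hx0 : x ≠ 0) (hx : ‖x‖ < 1) :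
    HasSum (fun k : ℕ => (-1) ^ k * x ^ (k ^ 2 + k) * (1 + x ^ (2 * k + 1)) /
      (1 - x ^ (2 * k + 1))) (ramanujanPsi x ^ 2) := by
  have hx2 := norm_sq_lt_one hx
  have hx1 : 1 - x ≠ 0 := by simpa using one_sub_pow_succ_ne_zero hx 0
  have hx1' : 1 + x ≠ 0 := by
    simpa using one_sub_pow_succ_ne_zero (p := -x) (by rwa [norm_neg]) 0
  have hx3 : x ^ 2 * x ^ 2 * x⁻¹ = x * x ^ 2 := by field_simp
  have hne : ∀ j : ℕ, x * (x ^ 2) ^ j ≠ 1 := mul_pow_ne_one_of_norm_lt_one hx2 hx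
  have hne3 : ∀ j : ℕ, x ^ 2 * x ^ 2 * x⁻¹ * (x ^ 2) ^ j ≠ 1 := by
    rw [hx3]; exact mul_mul_pow_ne_one hne
  have hsum := (hasSum_sixPhiFiveTerm_zero hx2 (mul_pow_ne_one_of_norm_lt_one hx2 hx2)
    hne3 hne3).mul_left ((1 + x) / (1 - x))
  have hterm (k : ℕ) : (1 + x) / (1 - x) * sixPhiFiveTerm (x ^ 2) (x ^ 2) x⁻¹ x⁻¹ 0 k =
      (-1) ^ k * x ^ (k ^ 2 + k) * (1 + x ^ (2 * k + 1)) / (1 - x ^ (2 * k + 1)) := by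
    have hk : 1 - x ^ (2 * k + 1) ≠ 0 := one_sub_pow_succ_ne_zero hx _
    rw [sixPhiFiveTerm, veryWellPoised_sq hx, wellPoisedRatio_sq_inv hx0 hx,
      wellPoisedRatio_zero_right, pow_add x (k ^ 2), ← pow_sq_sub_self_mul_pow]
    generalize 1 - x ^ (2 * k + 1) = d at *
    field_simp
    ring
  simp only [hterm] at hsum
  suffices hval : ramanujanPsi x ^ 2 = (1 + x) / (1 - x) *
      (qPochInf (x ^ 2 * x ^ 2) (x ^ 2) * qPochInf (x ^ 2 * x ^ 2 * x⁻¹ * x⁻¹) (x ^ 2) /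
        (qPochInf (x ^ 2 * x ^ 2 * x⁻¹) (x ^ 2) * qPochInf (x ^ 2 * x ^ 2 * x⁻¹) (x ^ 2))) by
    rwa [hval]
  rw [ramanujanPsi_eq_qPochInf_div hx0 hx, show x ^ 2 * x ^ 2 * x⁻¹ * x⁻¹ = x ^ 2 by field_simp,
    hx3, qPochInf_eq_mul hx2 x, qPochInf_eq_mul hx2 (x ^ 2)]
  have := qPochInf_ne_zero hx2 (mul_mul_pow_ne_one hne)
  field_simp
  ring

end theta

section clausen

variable {c p w y : ℂ}

/-- The array whose row and column sums telescope in Clausen's transformation of a Lambert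
series. -/
noncomputable def clausenTerm (c y p : ℂ) (n j : ℕ) : ℂ :=
  c ^ n * y ^ n * p ^ n ^ 2 * (y * p ^ n) ^ j / (1 - c * p ^ (n + j))

lemma exists_norm_clausenTerm_le (hp : ‖p‖ < 1) (hc : ‖c‖ < 1) :
    ∃ C, ∀ (y : ℂ) (n j : ℕ), ‖clausenTerm c y p n j‖ ≤ C * ‖y‖ ^ n * ‖y‖ ^ j := by
  have hlim : Tendsto (fun m : ℕ => (1 - c * p ^ m)⁻¹) atTop (𝓝 1) := by
    simpa using
      (((tendsto_pow_atTop_nhds_zero_of_norm_lt_one hp).const_mul c).const_sub 1).inv₀ (by simp)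
  obtain ⟨C, -, hC'⟩ := exists_forall_norm_le_of_tendsto hlim
  refine ⟨C, fun y n j => ?_⟩
  rw [clausenTerm, div_eq_mul_inv, mul_pow y]
  simp only [norm_mul, norm_pow]
  calc _ ≤ 1 * ‖y‖ ^ n * 1 * (‖y‖ ^ j * 1) * C := by
        gcongr
        exacts [pow_le_one₀ (norm_nonneg c) hc.le, pow_le_one₀ (norm_nonneg p) hp.le,
          pow_le_one₀ (by positivity) (pow_le_one₀ (norm_nonneg p) hp.le), hC' _]
    _ = C * ‖y‖ ^ n * ‖y‖ ^ j := by ring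

lemma clausenTerm_sub (hp : ‖p‖ < 1) (hc : ‖c‖ < 1) (y : ℂ) (n j : ℕ) :
    clausenTerm c y p n (j + 1) - clausenTerm c y p (n + 1) j =
      c ^ n * y ^ n * p ^ n ^ 2 * (y * p ^ n) * (y * p ^ n) ^ j := by
  have h : 1 - c * p ^ (n + (j + 1)) ≠ 0 :=
    sub_ne_zero.2 (mul_pow_ne_one_of_norm_lt_one hp hc _).symm
  rw [clausenTerm, clausenTerm, show n + 1 + j = n + (j + 1) by ring, ← sub_div, div_eq_iff h]
  ring

lemma tsum_clausenTerm_sub (hp : ‖p‖ < 1) (hc : ‖c‖ < 1) (hy : ‖y‖ < 1) (n : ℕ) :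
    ∑' j, clausenTerm c y p n j - ∑' j, clausenTerm c y p (n + 1) j =
      c ^ n * y ^ n * p ^ n ^ 2 * (1 - c * y * p ^ (2 * n)) /
        ((1 - c * p ^ n) * (1 - y * p ^ n)) := by
  obtain ⟨C, hbound⟩ := exists_norm_clausenTerm_le hp hc
  have hs (n : ℕ) : Summable (clausenTerm c y p n) :=
    .of_norm_bounded ((summable_geometric_of_lt_one (norm_nonneg y) hy).mul_left _) (hbound y n)
  have hyp : ‖y * p ^ n‖ < 1 := by
    rw [norm_mul, norm_pow]
    exact mul_lt_one_of_nonneg_of_lt_one_left (norm_nonneg y) hy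
      (pow_le_one₀ (norm_nonneg p) hp.le)
  have h₁ : 1 - c * p ^ n ≠ 0 := sub_ne_zero.2 (mul_pow_ne_one_of_norm_lt_one hp hc n).symm
  have h₂ : 1 - y * p ^ n ≠ 0 := sub_ne_zero.2 (mul_pow_ne_one_of_norm_lt_one hp hy n).symm
  rw [(hs n).tsum_eq_zero_add, add_sub_assoc,
    ← ((summable_nat_add_iff 1).2 (hs n)).tsum_sub (hs (n + 1))]
  simp only [clausenTerm_sub hp hc]
  rw [tsum_mul_left, tsum_geometric_of_norm_lt_one hyp, clausenTerm, add_zero, pow_zero,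
    mul_one, show 1 - c * y * p ^ (2 * n) = 1 - c * p ^ n * (y * p ^ n) by ring]
  generalize y * p ^ n = z at *
  field_simp
  ring

theorem hasSum_clausen (hp : ‖p‖ < 1) (hc : ‖c‖ < 1) (hy : ‖y‖ < 1) :
    HasSum (fun n : ℕ => c ^ n * y ^ n * p ^ n ^ 2 * (1 - c * y * p ^ (2 * n)) /
      ((1 - c * p ^ n) * (1 - y * p ^ n))) (∑' j : ℕ, y ^ j / (1 - c * p ^ j)) := by
  obtain ⟨C, hbound⟩ := exists_norm_clausenTerm_le hp hc
  have hgeom := hasSum_geometric_of_lt_one (norm_nonneg y) hy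
  have hrow (n : ℕ) : ‖∑' j, clausenTerm c y p n j‖ ≤ C * ‖y‖ ^ n * (1 - ‖y‖)⁻¹ :=
    tsum_of_norm_bounded (hgeom.mul_left _) (hbound y n)
  have hmajorant : Summable fun n : ℕ => C * ‖y‖ ^ n * (1 - ‖y‖)⁻¹ :=
    (hgeom.summable.mul_left C).mul_right _
  have hsummable := Summable.of_norm_bounded hmajorant hrow
  have := hasSum_sub_succ_of_tendsto_zero (hsummable.sub ((summable_nat_add_iff 1).2 hsummable))
    hsummable.tendsto_atTop_zero
  simp only [tsum_clausenTerm_sub hp hc hy] at this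
  simpa only [clausenTerm, pow_zero, one_mul, mul_one, zero_add, zero_pow two_ne_zero] using this

lemma hasSum_ramanujanPsi_sq (hw0 : w ≠ 0) (hw : ‖w‖ < 1) :
    HasSum (fun j : ℕ => w ^ j / (1 + w ^ (2 * j + 1))) (ramanujanPsi (w ^ 2) ^ 2) := by
  have hw2 := norm_sq_lt_one hw
  have hc : ‖-w‖ < 1 := by rwa [norm_neg]
  have hden (j : ℕ) : 1 - -w * (w ^ 2) ^ j = 1 + w ^ (2 * j + 1) := by ring
  have hsummable : Summable fun j : ℕ => w ^ j / (1 + w ^ (2 * j + 1)) := by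
    obtain ⟨C, hbound⟩ := exists_norm_clausenTerm_le hw2 hc
    refine .of_norm_bounded ((summable_geometric_of_lt_one (norm_nonneg w) hw).mul_left C)
      fun j => ?_
    simpa only [clausenTerm, hden, pow_zero, zero_pow two_ne_zero, one_mul, mul_one, zero_add]
      using hbound w 0 j
  have hterm (n : ℕ) : (-w) ^ n * w ^ n * (w ^ 2) ^ n ^ 2 * (1 - -w * w * (w ^ 2) ^ (2 * n)) /
      ((1 - -w * (w ^ 2) ^ n) * (1 - w * (w ^ 2) ^ n)) =
      (-1) ^ n * (w ^ 2) ^ (n ^ 2 + n) * (1 + (w ^ 2) ^ (2 * n + 1)) /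
        (1 - (w ^ 2) ^ (2 * n + 1)) := by
    congr 1
    · rw [neg_pow]; ring
    · ring
  have hclausen := hasSum_clausen hw2 hc hw
  simp only [hterm] at hclausen
  simp only [hden] at hclausen
  rw [(hasSum_ramanujanPsi_sq_lambert (pow_ne_zero 2 hw0) hw2).unique hclausen]
  exact hsummable.hasSum

end clausen

section qGauss

variable {b p y : ℂ}

/-- The summand of the `q`-Gauss series `₂φ₁(b, p^{N+1}; b y p^{N+1}; p, y)`, normalized by
`(p; p)_N / (b y; p)_{N+1}`. -/
noncomputable def qGaussTerm (b p y : ℂ) (N m : ℕ) : ℂ :=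
  qPoch b p m * qPoch p p (N + m) / (qPoch p p m * qPoch (b * y) p (N + 1 + m)) * y ^ m

lemma exists_norm_qGaussTerm_le (hp : ‖p‖ < 1) (hby : ∀ j : ℕ, b * y * p ^ j ≠ 1) :
    ∃ C > 0, ∀ N m : ℕ, ‖qGaussTerm b p y N m‖ ≤ C * ‖y‖ ^ m := by
  obtain ⟨B, hB, hB'⟩ := exists_norm_qPoch_le hp ‖b‖
  obtain ⟨C, hC, hC'⟩ := exists_norm_qPoch_le hp ‖p‖
  obtain ⟨D, hD, hD'⟩ := exists_norm_qPoch_inv_le_of_norm_le hp hp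
  obtain ⟨E, hE, hE'⟩ := exists_norm_qPoch_inv_le hp (isCompact_singleton (x := b * y))
    (by simpa using hby)
  refine ⟨B * C * (D * E), by positivity, fun N m => ?_⟩
  rw [qGaussTerm, div_eq_mul_inv, mul_inv]
  simp only [norm_mul, norm_pow]
  gcongr
  exacts [hB' b le_rfl m, hC' p le_rfl _, hD' p le_rfl m, hE' _ rfl _]

lemma summable_qGaussTerm (hp : ‖p‖ < 1) (hy : ‖y‖ < 1) (hby : ∀ j : ℕ, b * y * p ^ j ≠ 1)
    (N : ℕ) : Summable (qGaussTerm b p y N) := by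
  obtain ⟨C, -, hC⟩ := exists_norm_qGaussTerm_le hp hby
  exact .of_norm_bounded ((summable_geometric_of_lt_one (norm_nonneg y) hy).mul_left C) (hC N)

lemma qGaussTerm_zero (hp : ∀ j : ℕ, p * p ^ j ≠ 1) (b y : ℂ) (m : ℕ) :
    qGaussTerm b p y 0 m = qPoch b p m / qPoch (b * y) p (m + 1) * y ^ m := by
  rw [qGaussTerm, zero_add, zero_add, add_comm 1 m, mul_comm (qPoch b p m),
    mul_div_mul_left _ _ (qPoch_ne_zero hp m)]

lemma hasSum_qGauss_zero (hp : ‖p‖ < 1) (hy : ‖y‖ < 1) (hby : ∀ j : ℕ, b * y * p ^ j ≠ 1) :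
    HasSum (fun m => qPoch b p m / qPoch (b * y) p (m + 1) * y ^ m) (1 - y)⁻¹ := by
  have hy₁ : 1 - y ≠ 0 := sub_ne_zero.2 fun h => by simp [← h] at hy
  set u : ℕ → ℂ := fun m => qPoch b p m / qPoch (b * y) p m * y ^ m with hu_def
  have hu (m : ℕ) : u m - u (m + 1) =
      (1 - y) * (qPoch b p m / qPoch (b * y) p (m + 1) * y ^ m) := by
    have h₁ := qPoch_ne_zero hby m
    have h₂ : 1 - b * y * p ^ m ≠ 0 := sub_ne_zero.2 (hby m).symm
    simp only [hu_def, qPoch_succ]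
    field_simp
    ring
  have hlim : Tendsto u atTop (𝓝 0) := by
    have hratio := (tendsto_qPoch hp b).div (tendsto_qPoch hp (b * y)) (qPochInf_ne_zero hp hby)
    simpa using hratio.mul (tendsto_pow_atTop_nhds_zero_of_norm_lt_one hy)
  have hs : Summable fun m => u m - u (m + 1) := by
    simpa only [hu, ← qGaussTerm_zero (mul_pow_ne_one_of_norm_lt_one hp hp)] using
      (summable_qGaussTerm hp hy hby 0).mul_left (1 - y)
  have hsum := (hasSum_sub_succ_of_tendsto_zero hs hlim).mul_left (1 - y)⁻¹
  simp only [hu, inv_mul_cancel_left₀ hy₁] at hsum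
  simpa [hu_def] using hsum

lemma qGaussTerm_succ_left (hby : ∀ j : ℕ, b * y * p ^ j ≠ 1) (N m : ℕ) :
    qGaussTerm b p y (N + 1) m * (1 - b * y * p ^ (N + 1 + m)) =
      qGaussTerm b p y N m * (1 - p ^ (N + 1 + m)) := by
  have h : 1 - b * y * p ^ (N + 1 + m) ≠ 0 := sub_ne_zero.2 (hby _).symm
  rw [qGaussTerm, qGaussTerm, add_right_comm N 1 m, add_right_comm (N + 1) 1 m,
    add_right_comm N 1 m, qPoch_succ p, qPoch_succ (b * y), ← pow_succ']
  rw [add_right_comm] at h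
  generalize 1 - b * y * p ^ (N + m + 1) = d at *
  rw [← mul_assoc (qPoch p p m), ← mul_assoc (qPoch b p m), ← div_div]
  field_simp

lemma qGaussTerm_succ_right (hp : ∀ j : ℕ, p * p ^ j ≠ 1) (hby : ∀ j : ℕ, b * y * p ^ j ≠ 1)
    (N m : ℕ) :
    qGaussTerm b p y N (m + 1) * ((1 - p ^ (m + 1)) * (1 - b * y * p ^ (N + 1 + m))) =
      qGaussTerm b p y N m * ((1 - b * p ^ m) * (1 - p ^ (N + 1 + m)) * y) := by
  have h₁ : 1 - b * y * p ^ (N + 1 + m) ≠ 0 := sub_ne_zero.2 (hby _).symm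
  have h₂ : 1 - p ^ (m + 1) ≠ 0 := sub_ne_zero.2 (by simpa only [pow_succ'] using (hp m).symm)
  rw [qGaussTerm, qGaussTerm, ← add_assoc, ← add_assoc, qPoch_succ b, qPoch_succ p p m,
    qPoch_succ p p (N + m), qPoch_succ (b * y), ← pow_succ', ← pow_succ', pow_succ y,
    add_right_comm N m 1]
  generalize 1 - b * y * p ^ (N + 1 + m) = d at *
  generalize 1 - p ^ (m + 1) = e at *
  rw [mul_mul_mul_comm (qPoch b p m), mul_mul_mul_comm (qPoch p p m), mul_div_mul_comm]
  field_simp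

lemma qGaussTerm_contiguous (hp : ∀ j : ℕ, p * p ^ j ≠ 1) (hby : ∀ j : ℕ, b * y * p ^ j ≠ 1)
    (N m : ℕ) :
    (1 - y * p ^ (N + 1)) * qGaussTerm b p y (N + 1) m -
        (1 - p ^ (N + 1)) * qGaussTerm b p y N m =
      p ^ (N + 1) * (1 - p ^ m) * qGaussTerm b p y N m -
        p ^ (N + 1) * (1 - p ^ (m + 1)) * qGaussTerm b p y N (m + 1) := by
  have h : 1 - b * y * p ^ (N + 1 + m) ≠ 0 := sub_ne_zero.2 (hby _).symm
  refine mul_right_cancel₀ h ?_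
  linear_combination (1 - y * p ^ (N + 1)) * qGaussTerm_succ_left hby N m +
    p ^ (N + 1) * qGaussTerm_succ_right hp hby N m

theorem hasSum_qGaussTerm (hp : ‖p‖ < 1) (hy : ‖y‖ < 1) (hby : ∀ j : ℕ, b * y * p ^ j ≠ 1)
    (N : ℕ) : HasSum (qGaussTerm b p y N) (qPoch p p N / qPoch y p (N + 1)) := by
  have hpp := mul_pow_ne_one_of_norm_lt_one hp hp
  induction N with
  | zero =>
    rw [funext (qGaussTerm_zero hpp b y)]
    simpa [qPoch_succ] using hasSum_qGauss_zero hp hy hby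
  | succ N ih =>
    have hyN : 1 - y * p ^ (N + 1) ≠ 0 :=
      sub_ne_zero.2 (mul_pow_ne_one_of_norm_lt_one hp hy _).symm
    have hs := (summable_qGaussTerm hp hy hby (N + 1)).hasSum
    set u : ℕ → ℂ := fun m => p ^ (N + 1) * (1 - p ^ m) * qGaussTerm b p y N m with hu_def
    have hu : Tendsto u atTop (𝓝 0) := by
      have hfactor : Tendsto (fun m : ℕ => p ^ (N + 1) * (1 - p ^ m)) atTop
          (𝓝 (p ^ (N + 1) * (1 - 0))) :=
        ((tendsto_pow_atTop_nhds_zero_of_norm_lt_one hp).const_sub 1).const_mul _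
      simpa only [mul_zero] using hfactor.mul ih.summable.tendsto_atTop_zero
    have hdiff := (hs.mul_left (1 - y * p ^ (N + 1))).sub (ih.mul_left (1 - p ^ (N + 1)))
    simp only [qGaussTerm_contiguous hpp hby] at hdiff
    have hvalue := hdiff.unique (hasSum_sub_succ_of_tendsto_zero hdiff.summable hu)
    simp only [pow_zero, sub_self, mul_zero, zero_mul, sub_eq_zero] at hvalue
    have hsucc : ∑' m, qGaussTerm b p y (N + 1) m =
        qPoch p p (N + 1) / qPoch y p (N + 1 + 1) := by
      rw [qPoch_succ, qPoch_succ y p (N + 1), ← pow_succ', mul_div_mul_comm, mul_div_assoc',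
        eq_div_iff hyN, mul_comm, hvalue, mul_comm]
    rwa [hsucc] at hs

end qGauss

section lambert

variable {b p y : ℂ}

/-- The summand of `∑ (b; p)_n yⁿ / ((b y; p)_n (1 - pⁿ))`, with the index shifted to start at `0`.
The series is minus the derivative at `c = 1` of the `q`-Gauss series `₂φ₁(b, c; b c y; p, y)`. -/
noncomputable def qGaussDeriv (b p y : ℂ) (n : ℕ) : ℂ :=
  qPoch b p (n + 1) / (qPoch (b * y) p (n + 1) * (1 - p ^ (n + 1))) * y ^ (n + 1)

/-- The summand of the difference of the Lambert series of `c` and `d`. -/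
noncomputable def lambertDiff (c d p : ℂ) (i : ℕ) : ℂ :=
  c * p ^ i / (1 - c * p ^ i) - d * p ^ i / (1 - d * p ^ i)

lemma norm_one_sub_inv_le {c : ℂ} {r : ℝ} (hc : ‖c‖ ≤ r) (hr : r < 1) :
    ‖(1 - c)⁻¹‖ ≤ (1 - r)⁻¹ := by
  rw [norm_inv]
  refine inv_anti₀ (sub_pos.2 hr) ?_
  calc 1 - r ≤ ‖(1 : ℂ)‖ - ‖c‖ := by rw [norm_one]; gcongr
    _ ≤ ‖1 - c‖ := norm_sub_norm_le 1 c

lemma norm_one_sub_pow_succ_inv_le (hp : ‖p‖ < 1) (n : ℕ) :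
    ‖(1 - p ^ (n + 1))⁻¹‖ ≤ (1 - ‖p‖)⁻¹ :=
  norm_one_sub_inv_le (by
    rw [norm_pow]; exact pow_le_of_le_one (norm_nonneg p) hp.le n.succ_ne_zero) hp

lemma exists_norm_qGaussDeriv_le (hp : ‖p‖ < 1) (b : ℂ) {r : ℝ} (hr : r < 1) :
    ∃ C > 0, ∀ y : ℂ, ‖b * y‖ ≤ r → ∀ n, ‖qGaussDeriv b p y n‖ ≤ C * ‖y‖ ^ (n + 1) := by
  obtain ⟨C, hC, hC'⟩ := exists_norm_qPoch_le hp ‖b‖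
  obtain ⟨D, hD, hD'⟩ := exists_norm_qPoch_inv_le_of_norm_le hp hr
  have := sub_pos.2 hp
  refine ⟨C * (D * (1 - ‖p‖)⁻¹), by positivity, fun y hy n => ?_⟩
  rw [qGaussDeriv, div_eq_mul_inv, mul_inv, norm_mul, norm_mul, norm_mul, norm_pow]
  gcongr
  exacts [hC' b le_rfl _, hD' _ hy _, norm_one_sub_pow_succ_inv_le hp n]

lemma summable_qGaussDeriv (hp : ‖p‖ < 1) (hy : ‖y‖ < 1) (hby : ‖b * y‖ < 1) :
    Summable (qGaussDeriv b p y) := by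
  obtain ⟨C, -, hC⟩ := exists_norm_qGaussDeriv_le hp b hby
  exact .of_norm_bounded (((summable_nat_add_iff 1).2
    (summable_geometric_of_lt_one (norm_nonneg y) hy)).mul_left C) (hC y le_rfl)

lemma norm_mul_pow_le (hp : ‖p‖ < 1) (c : ℂ) (n : ℕ) : ‖c * p ^ n‖ ≤ ‖c‖ := by
  rw [norm_mul, norm_pow]
  exact mul_le_of_le_one_right (norm_nonneg c) (pow_le_one₀ (norm_nonneg p) hp.le)

lemma qGaussDeriv_sub (hp : ‖p‖ < 1) (hby : ∀ j : ℕ, b * y * p ^ j ≠ 1) (n : ℕ) :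
    qGaussDeriv b p y n - qGaussDeriv b p (y * p) n =
      qPoch b p (n + 1) / qPoch (b * y) p (n + 1 + 1) * y ^ (n + 1) := by
  have hshift : (1 - b * y) * qPoch (b * (y * p)) p (n + 1) =
      qPoch (b * y) p (n + 1) * (1 - b * y * p ^ (n + 1)) := by
    rw [← mul_assoc, ← qPoch_succ', qPoch_succ]
  have h₁ := qPoch_ne_zero hby (n + 1)
  have h₂ : 1 - b * y * p ^ (n + 1) ≠ 0 := sub_ne_zero.2 (hby _).symm
  have h₃ := one_sub_pow_succ_ne_zero hp n
  have h₄ : 1 - b * y ≠ 0 := sub_ne_zero.2 (by simpa using (hby 0).symm)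
  rw [qGaussDeriv, qGaussDeriv, qPoch_succ (b * y) p (n + 1), mul_pow,
    eq_div_of_mul_eq h₄ ((mul_comm _ _).trans hshift)]
  generalize p ^ (n + 1) = P at *
  field_simp
  ring

lemma tsum_qGaussDeriv_sub (hp : ‖p‖ < 1) (hy : ‖y‖ < 1) (hby : ‖b * y‖ < 1) :
    ∑' n, qGaussDeriv b p y n - ∑' n, qGaussDeriv b p (y * p) n = lambertDiff y (b * y) p 0 := by
  have hne := mul_pow_ne_one_of_norm_lt_one hp hby
  have hyp : ‖y * p‖ < 1 := by simpa using (norm_mul_pow_le hp y 1).trans_lt hy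
  have hbyp : ‖b * (y * p)‖ < 1 := by
    simpa [← mul_assoc] using (norm_mul_pow_le hp (b * y) 1).trans_lt hby
  have hy₁ : 1 - y ≠ 0 := by simpa using one_sub_pow_succ_ne_zero hy 0
  have hby₁ : 1 - b * y ≠ 0 := by simpa using one_sub_pow_succ_ne_zero hby 0
  rw [← (summable_qGaussDeriv hp hy hby).tsum_sub (summable_qGaussDeriv hp hyp hbyp)]
  simp only [qGaussDeriv_sub hp hne]
  rw [((hasSum_nat_add_iff' 1).2 (hasSum_qGauss_zero hp hy hne)).tsum_eq]
  simp only [sum_range_one, qPoch_zero, qPoch_succ, pow_zero, mul_one, one_mul, lambertDiff]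
  generalize b * y = c at *
  field_simp
  ring

lemma lambertDiff_mul_pow (c d p : ℂ) (N i : ℕ) :
    lambertDiff (c * p ^ N) (d * p ^ N) p i = lambertDiff c d p (N + i) := by
  simp only [lambertDiff, pow_add, mul_assoc]

lemma exists_norm_lambert_le (hp : ‖p‖ < 1) {K : Set ℂ} (hK : IsCompact K)
    (hne : ∀ c ∈ K, ∀ j : ℕ, c * p ^ j ≠ 1) :
    ∃ C > 0, ∀ c ∈ K, ∀ i, ‖c * p ^ i / (1 - c * p ^ i)‖ ≤ C * ‖p‖ ^ i := by
  obtain ⟨R, hR, hKR⟩ := hK.isBounded.exists_pos_norm_le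
  obtain ⟨C, hC, hC'⟩ := exists_norm_qPoch_le hp R
  obtain ⟨D, hD, hD'⟩ := exists_norm_qPoch_inv_le hp hK hne
  refine ⟨R * (C * D), by positivity, fun c hc i => ?_⟩
  have hfactor : (1 - c * p ^ i)⁻¹ = qPoch c p i * (qPoch c p (i + 1))⁻¹ := by
    rw [qPoch_succ, mul_inv, mul_inv_cancel_left₀ (qPoch_ne_zero (hne c hc) i)]
  calc ‖c * p ^ i / (1 - c * p ^ i)‖
      = ‖c‖ * ‖p‖ ^ i * (‖qPoch c p i‖ * ‖(qPoch c p (i + 1))⁻¹‖) := by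
        rw [div_eq_mul_inv, hfactor, norm_mul, norm_mul, norm_mul, norm_pow]
    _ ≤ R * ‖p‖ ^ i * (C * D) := by
        gcongr
        exacts [hKR c hc, hC' c (hKR c hc) i, hD' c hc _]
    _ = R * (C * D) * ‖p‖ ^ i := by ring

lemma exists_norm_lambertDiff_le (hp : ‖p‖ < 1) {K L : Set ℂ} (hK : IsCompact K)
    (hL : IsCompact L) (hKne : ∀ c ∈ K, ∀ j : ℕ, c * p ^ j ≠ 1)
    (hLne : ∀ c ∈ L, ∀ j : ℕ, c * p ^ j ≠ 1) :
    ∃ C > 0, ∀ c ∈ K, ∀ d ∈ L, ∀ i, ‖lambertDiff c d p i‖ ≤ C * ‖p‖ ^ i := by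
  obtain ⟨C, hC, hC'⟩ := exists_norm_lambert_le hp hK hKne
  obtain ⟨D, hD, hD'⟩ := exists_norm_lambert_le hp hL hLne
  refine ⟨C + D, by positivity, fun c hc d hd i => ?_⟩
  rw [lambertDiff, add_mul]
  exact (norm_sub_le _ _).trans (add_le_add (hC' c hc i) (hD' d hd i))

lemma summable_lambertDiff (hp : ‖p‖ < 1) {c d : ℂ} (hc : ∀ j : ℕ, c * p ^ j ≠ 1)
    (hd : ∀ j : ℕ, d * p ^ j ≠ 1) : Summable (lambertDiff c d p) := by
  obtain ⟨C, -, hC⟩ := exists_norm_lambertDiff_le hp (isCompact_singleton (x := c))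
    (isCompact_singleton (x := d)) (by simpa using hc) (by simpa using hd)
  exact .of_norm_bounded ((summable_geometric_of_lt_one (norm_nonneg p) hp).mul_left C)
    (hC c rfl d rfl)

theorem hasSum_qGaussDeriv (hp : ‖p‖ < 1) (hy : ‖y‖ < 1) (hby : ‖b * y‖ < 1) :
    HasSum (qGaussDeriv b p y) (∑' i, lambertDiff y (b * y) p i) := by
  have hyN (N : ℕ) : ‖y * p ^ N‖ < 1 := (norm_mul_pow_le hp y N).trans_lt hy
  have hbyN (N : ℕ) : ‖b * (y * p ^ N)‖ < 1 := by
    simpa only [mul_assoc] using (norm_mul_pow_le hp (b * y) N).trans_lt hby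
  set u : ℕ → ℂ := fun N => ∑' n, qGaussDeriv b p (y * p ^ N) n with hu_def
  have hu (N : ℕ) : u N - u (N + 1) = lambertDiff y (b * y) p N := by
    simpa only [hu_def, pow_succ, ← mul_assoc, lambertDiff_mul_pow, add_zero] using
      tsum_qGaussDeriv_sub hp (hyN N) (hbyN N)
  have hlim : Tendsto u atTop (𝓝 0) := by
    obtain ⟨C, hC, hC'⟩ := exists_norm_qGaussDeriv_le hp b hby
    have hgeom : Summable fun n : ℕ => C * ‖y‖ ^ (n + 1) :=
      ((summable_nat_add_iff 1).2 (summable_geometric_of_lt_one (norm_nonneg y) hy)).mul_left C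
    have hle (N : ℕ) : ‖u N‖ ≤ (∑' n, C * ‖y‖ ^ (n + 1)) * ‖p‖ ^ N := by
      refine tsum_of_norm_bounded (hgeom.hasSum.mul_right _) fun n => ?_
      calc ‖qGaussDeriv b p (y * p ^ N) n‖ ≤ C * ‖y * p ^ N‖ ^ (n + 1) :=
            hC' _ ((mul_assoc b y _ ▸ norm_mul_pow_le hp (b * y) N)) n
        _ = C * ‖y‖ ^ (n + 1) * (‖p‖ ^ N) ^ (n + 1) := by
            rw [norm_mul, norm_pow, mul_pow, mul_assoc]
        _ ≤ C * ‖y‖ ^ (n + 1) * ‖p‖ ^ N := by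
            gcongr
            exact pow_le_of_le_one (by positivity) (pow_le_one₀ (norm_nonneg p) hp.le)
              n.succ_ne_zero
    refine squeeze_zero_norm hle ?_
    simpa using (tendsto_pow_atTop_nhds_zero_of_lt_one (norm_nonneg p) hp).const_mul
      (∑' n, C * ‖y‖ ^ (n + 1))
  have hs := summable_lambertDiff hp (mul_pow_ne_one_of_norm_lt_one hp hy)
    (mul_pow_ne_one_of_norm_lt_one hp hby)
  have hsum := hasSum_sub_succ_of_tendsto_zero (by simpa only [hu] using hs) hlim
  simp only [hu] at hsum
  rw [hsum.tsum_eq]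
  simpa [hu_def] using (summable_qGaussDeriv hp hy hby).hasSum

end lambert

section expansion

variable {a p x : ℂ}

lemma qPoch_mul_inv_pow (ha : a ≠ 0) (hp : p ≠ 0) (x : ℂ) (n : ℕ) :
    qPoch (a * p * x * (p ^ n)⁻¹) p n = (∏ j ∈ range n, (-a / p ^ j)) * qPochHom a⁻¹ x p n := by
  rw [qPoch, ← prod_range_reflect, qPochHom, ← prod_mul_distrib]
  refine prod_congr rfl fun j hj => ?_
  obtain ⟨i, rfl⟩ := Nat.exists_eq_add_of_lt (mem_range.1 hj)
  rw [show j + i + 1 - 1 - j = i by lia, pow_succ, pow_add]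
  field_simp
  ring

lemma qPoch_mul_inv_pow_div (ha : a ≠ 0) (hp : p ≠ 0) (x : ℂ) (n : ℕ) :
    qPoch (a * p * x * (p ^ n)⁻¹) p n / qPoch (a * p * (p ^ n)⁻¹) p n =
      qPochHom a⁻¹ x p n / qPoch a⁻¹ p n := by
  have hD : ∏ j ∈ range n, (-a / p ^ j) ≠ 0 :=
    prod_ne_zero_iff.2 fun j _ => div_ne_zero (neg_ne_zero.2 ha) (pow_ne_zero j hp)
  have hone := qPoch_mul_inv_pow ha hp 1 n
  rw [mul_one, qPochHom_one_right] at hone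
  rw [qPoch_mul_inv_pow ha hp, hone, mul_div_mul_left _ _ hD]

lemma mul_inv_pow_mul_pow_ne_one (hp : p ≠ 0) (ha : ∀ j : ℕ, a * p ^ j ≠ 1)
    (hb : ∀ j : ℕ, a⁻¹ * p ^ j ≠ 1) (n j : ℕ) : a * p * (p ^ n)⁻¹ * p ^ j ≠ 1 := by
  intro h
  rcases le_or_gt n (j + 1) with hj | hj
  · obtain ⟨i, hi⟩ := Nat.exists_eq_add_of_le hj
    have hpow : p * p ^ j = p ^ n * p ^ i := by rw [← pow_succ', hi, pow_add]
    refine ha i ?_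
    rw [← h, mul_right_comm, mul_assoc a, hpow]
    field_simp
  · obtain ⟨i, rfl⟩ := Nat.exists_eq_add_of_lt hj
    refine hb (i + 1) ?_
    rw [← inv_inj, inv_one, mul_inv, inv_inv, ← h]
    field_simp
    ring

lemma wellPoisedRatio_inv_pow_mul_pow_succ (ha0 : a ≠ 0) (hp0 : p ≠ 0)
    (ha : ∀ j : ℕ, a * p ^ j ≠ 1) (hb : ∀ j : ℕ, a⁻¹ * p ^ j ≠ 1) {n k m : ℕ}
    (hn : n = k + 1 + m) :
    wellPoisedRatio a p (p ^ n)⁻¹ (k + 1) * wellPoisedRatio a p (p ^ n) (k + 1) *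
        ((1 - a⁻¹ * p ^ m) * (1 - a * p * p ^ (n + k)) * (a * p)) =
      wellPoisedRatio a p (p ^ n)⁻¹ k * wellPoisedRatio a p (p ^ n) k *
        ((1 - p ^ n * p ^ k) * (1 - p * p ^ m)) := by
  have hne (j : ℕ) : a * p * p ^ n * p ^ j ≠ 1 := by
    simpa only [pow_add, pow_one, mul_assoc] using ha (1 + n + j)
  have hinv := wellPoisedRatio_succ (mul_inv_pow_mul_pow_ne_one hp0 ha hb n) k
  have hpow := wellPoisedRatio_succ hne k
  have hpn : p ^ n = p ^ k * p * p ^ m := by rw [hn, pow_add, pow_succ]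
  have hinv' : wellPoisedRatio a p (p ^ n)⁻¹ (k + 1) * ((1 - a⁻¹ * p ^ m) * (a * p) * p ^ k) =
      wellPoisedRatio a p (p ^ n)⁻¹ k * (p ^ n * p ^ k - 1) := by
    have hleft : (1 - a⁻¹ * p ^ m) * (a * p) * p ^ k =
        -(p ^ n) * (1 - a * (p ^ n)⁻¹ * p ^ (k + 1)) := by
      rw [hpn]
      field_simp
      ring
    have hright : p ^ n * p ^ k - 1 = -(p ^ n) * ((p ^ n)⁻¹ - p ^ k) := by
      rw [mul_sub, neg_mul, mul_inv_cancel₀ (pow_ne_zero n hp0)]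
      ring
    rw [hleft, hright]
    linear_combination -(p ^ n) * hinv
  refine mul_right_cancel₀ (pow_ne_zero k hp0) ?_
  rw [pow_add]
  rw [pow_succ] at hpow
  linear_combination wellPoisedRatio a p (p ^ n) (k + 1) * (1 - a * p ^ n * (p ^ k * p)) * hinv' +
    wellPoisedRatio a p (p ^ n)⁻¹ k * (p ^ n * p ^ k - 1) *
      (hpow + wellPoisedRatio a p (p ^ n) k * hpn)

lemma wellPoisedRatio_inv_pow_mul_pow (ha0 : a ≠ 0) (hp0 : p ≠ 0) (hp : ∀ j : ℕ, p * p ^ j ≠ 1)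
    (ha : ∀ j : ℕ, a * p ^ j ≠ 1) (hb : ∀ j : ℕ, a⁻¹ * p ^ j ≠ 1) {n k m : ℕ} (hn : n = k + m) :
    wellPoisedRatio a p (p ^ n)⁻¹ k * wellPoisedRatio a p (p ^ n) k * (a * p) ^ k *
        (qPoch a⁻¹ p n * qPoch p p m * qPoch (a * p) p (n + k)) =
      qPoch (p ^ n) p k * qPoch p p n * qPoch a⁻¹ p m * qPoch (a * p) p n := by
  induction k generalizing m with
  | zero =>
    subst hn
    simp only [wellPoisedRatio, qPochHom_zero, qPoch_zero, pow_zero, zero_add, add_zero]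
    ring
  | succ k ih =>
    have hk := ih (m := m + 1) (by lia)
    have hstep := wellPoisedRatio_inv_pow_mul_pow_succ ha0 hp0 ha hb hn
    have h₁ : 1 - a⁻¹ * p ^ m ≠ 0 := sub_ne_zero.2 (hb m).symm
    have h₂ : 1 - p * p ^ m ≠ 0 := sub_ne_zero.2 (hp m).symm
    rw [qPoch_succ, qPoch_succ] at hk
    rw [qPoch_succ, ← add_assoc, qPoch_succ, pow_succ]
    refine mul_right_cancel₀ (mul_ne_zero h₁ h₂) ?_
    linear_combination (a * p) ^ k * qPoch a⁻¹ p n * qPoch p p m * (1 - p * p ^ m) *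
      qPoch (a * p) p (n + k) * hstep + (1 - p ^ n * p ^ k) * (1 - p * p ^ m) * hk

/-- The terminating `₆φ₅` sum with `y = p⁻ⁿ`, read as an expansion in the functions
`wellPoisedRatio a p x k` of `x`. -/
lemma qPochHom_div_qPoch_eq_sum (ha0 : a ≠ 0) (hp0 : p ≠ 0) (hp : ∀ j : ℕ, p * p ^ j ≠ 1)
    (ha : ∀ j : ℕ, a * p ^ j ≠ 1) (hx : ∀ j : ℕ, a * p * x * p ^ j ≠ 1)
    (hb : ∀ j : ℕ, a⁻¹ * p ^ j ≠ 1) (n : ℕ) :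
    qPochHom a⁻¹ x p n / qPoch (a * p * x) p n =
      ∑ k ∈ range (n + 1), veryWellPoised a p k * wellPoisedRatio a p x k *
        (qPoch (p ^ n) p k * qPoch p p n * qPoch a⁻¹ p (n - k) /
          (qPoch p p (n - k) * qPoch (a * p) p (n + k))) := by
  have hap := qPoch_ne_zero (mul_mul_pow_ne_one ha)
  have hbn := qPoch_ne_zero hb n
  have hsum := sum_sixPhiFiveTerm hp ha hx (mul_inv_pow_mul_pow_ne_one hp0 ha hb n) n.lt_succ_self
  rw [mul_div_mul_comm, qPoch_mul_inv_pow_div ha0 hp0] at hsum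
  calc qPochHom a⁻¹ x p n / qPoch (a * p * x) p n
      = qPoch (a * p) p n / qPoch (a * p * x) p n * (qPochHom a⁻¹ x p n / qPoch a⁻¹ p n) *
          (qPoch a⁻¹ p n / qPoch (a * p) p n) := by
        have hapn := hap n
        generalize qPoch a⁻¹ p n = B at hbn ⊢
        field_simp
    _ = _ := ?_
  rw [← hsum, sum_mul]
  refine sum_congr rfl fun k hk => ?_
  have hpoised := wellPoisedRatio_inv_pow_mul_pow ha0 hp0 hp ha hb
    (Nat.add_sub_of_le (Nat.lt_succ_iff.1 (mem_range.1 hk))).symm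
  have hpm := qPoch_ne_zero hp (n - k)
  have hapn := hap n
  have hapk := hap (n + k)
  rw [sixPhiFiveTerm, mul_assoc _ (wellPoisedRatio a p (p ^ n)⁻¹ k), mul_assoc _ _ ((a * p) ^ k),
    mul_assoc _ (_ * _ * _) (_ / _)]
  congr 1
  rw [mul_div_assoc', div_eq_div_iff hapn (mul_ne_zero hpm hapk)]
  linear_combination hpoised

lemma qPochHom_succ_div_eq_sum (ha0 : a ≠ 0) (hp0 : p ≠ 0) (hp : ∀ j : ℕ, p * p ^ j ≠ 1)
    (ha : ∀ j : ℕ, a * p ^ j ≠ 1) (hx : ∀ j : ℕ, a * p * x * p ^ j ≠ 1)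
    (hb : ∀ j : ℕ, a⁻¹ * p ^ j ≠ 1) (n : ℕ) :
    qPochHom a⁻¹ x p (n + 1) / (qPoch (a * p * x) p (n + 1) * (1 - p ^ (n + 1))) =
      qPoch a⁻¹ p (n + 1) / (qPoch (a * p) p (n + 1) * (1 - p ^ (n + 1))) +
      ∑ k ∈ range (n + 1), veryWellPoised a p (k + 1) * wellPoisedRatio a p x (k + 1) *
        (qPoch a⁻¹ p (n - k) * qPoch p p (2 * k + 1 + (n - k)) /
          (qPoch p p (n - k) * qPoch (a * p) p (2 * k + 1 + 1 + (n - k)))) := by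
  have hpn : 1 - p ^ (n + 1) ≠ 0 := by rw [pow_succ']; exact sub_ne_zero.2 (hp n).symm
  have ha₁ : 1 - a ≠ 0 := sub_ne_zero.2 (by simpa using (ha 0).symm)
  rw [← div_div, qPochHom_div_qPoch_eq_sum ha0 hp0 hp ha hx hb, sum_range_succ', add_div, add_comm,
    sum_div]
  congr 1
  · simp only [veryWellPoised, wellPoisedRatio, mul_zero, pow_zero, mul_one, qPoch_zero,
      qPochHom_zero, div_one, Nat.sub_zero, add_zero, one_mul, div_self ha₁]
    rw [mul_div_mul_left _ _ (qPoch_ne_zero hp (n + 1)), div_div]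
  · refine sum_congr rfl fun k hk => ?_
    have hkn : k ≤ n := Nat.lt_succ_iff.1 (mem_range.1 hk)
    rw [Nat.add_sub_add_right, show 2 * k + 1 + (n - k) = n + (k + 1) by lia,
      show 2 * k + 1 + 1 + (n - k) = n + 1 + (k + 1) by lia, qPoch_add p p n (k + 1),
      qPoch_succ p p n, ← pow_succ']
    field_simp

end expansion

section transformation

variable {a p x : ℂ}

/-- The `n`-th summand of `∑ (1 / (a x); p)_n (a² p x)ⁿ / ((a p x; p)_n (1 - pⁿ))`, with the index
shifted to start at `n = 0`. -/
noncomputable def wellPoisedTerm (a p x : ℂ) (n : ℕ) : ℂ :=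
  qPochHom a⁻¹ x p (n + 1) / (qPoch (a * p * x) p (n + 1) * (1 - p ^ (n + 1))) *
    (a ^ 2 * p) ^ (n + 1)

/-- The summand of the very-well-poised series with parameter `1 / x`, with the index shifted to
start at `0`. -/
noncomputable def veryWellPoisedTerm (a p x : ℂ) (k : ℕ) : ℂ :=
  veryWellPoised a p (k + 1) * wellPoisedRatio a p x (k + 1) *
    (qPoch p p (2 * k + 1) / qPoch (a ^ 2 * p) p (2 * k + 2)) * (a ^ 2 * p) ^ (k + 1)

/-- The values of `a` for which the well-poised transformation with base `p` holds; the part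
`|a² p| = 1` of the boundary is included. -/
def wellPoisedDomain (p : ℂ) : Set ℂ :=
  {a | 1 < ‖a‖ ∧ ‖a ^ 2 * p‖ ≤ 1 ∧ a ^ 2 * p ≠ 1}

lemma ne_zero_of_mem_wellPoisedDomain (ha : a ∈ wellPoisedDomain p) : a ≠ 0 :=
  norm_pos_iff.1 (one_pos.trans ha.1)

lemma norm_mul_lt_one_of_mem_wellPoisedDomain (hp : p ≠ 0) (ha : a ∈ wellPoisedDomain p) :
    ‖a * p‖ < 1 := by
  have hpos : 0 < ‖a * p‖ := norm_pos_iff.2 (mul_ne_zero (ne_zero_of_mem_wellPoisedDomain ha) hp)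
  calc ‖a * p‖ < ‖a‖ * ‖a * p‖ := lt_mul_of_one_lt_left hpos ha.1
    _ = ‖a ^ 2 * p‖ := by rw [← norm_mul, sq, mul_assoc]
    _ ≤ 1 := ha.2.1

lemma norm_mul_mul_lt_one_of_mem_wellPoisedDomain (hp : p ≠ 0) (ha : a ∈ wellPoisedDomain p)
    (hx : ‖x‖ ≤ 1) : ‖a * p * x‖ < 1 := by
  rw [norm_mul]
  exact mul_lt_one_of_nonneg_of_lt_one_left (norm_nonneg _)
    (norm_mul_lt_one_of_mem_wellPoisedDomain hp ha) hx

lemma mul_pow_ne_one_of_mem_wellPoisedDomain (hp0 : p ≠ 0) (hp : ‖p‖ < 1)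
    (ha : a ∈ wellPoisedDomain p) (j : ℕ) : a * p ^ j ≠ 1 := by
  cases j with
  | zero => rintro h; exact ha.1.ne' (by rw [← norm_one (α := ℂ), ← h, pow_zero, mul_one])
  | succ j =>
    rw [pow_succ', ← mul_assoc]
    exact mul_pow_ne_one_of_norm_lt_one hp (norm_mul_lt_one_of_mem_wellPoisedDomain hp0 ha) j

lemma sq_mul_mul_pow_ne_one_of_mem_wellPoisedDomain (hp : ‖p‖ < 1)
    (ha : a ∈ wellPoisedDomain p) (j : ℕ) : a ^ 2 * p * p ^ j ≠ 1 := by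
  cases j with
  | zero => simpa using ha.2.2
  | succ j =>
    have hlt : ‖a ^ 2 * p * p‖ < 1 := by
      rw [norm_mul]
      exact mul_lt_one_of_nonneg_of_lt_one_right ha.2.1 (norm_nonneg p) hp
    simpa only [pow_succ' p, mul_assoc] using mul_pow_ne_one_of_norm_lt_one hp hlt j

lemma norm_inv_lt_one_of_mem_wellPoisedDomain (ha : a ∈ wellPoisedDomain p) : ‖a⁻¹‖ < 1 := by
  rw [norm_inv]
  exact inv_lt_one_of_one_lt₀ ha.1

/-- The double series whose row sums are `veryWellPoisedTerm` and whose antidiagonal sums are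
`wellPoisedTerm` minus a Lambert term. -/
noncomputable def transformationTerm (a p x : ℂ) (i : ℕ × ℕ) : ℂ :=
  veryWellPoised a p (i.1 + 1) * wellPoisedRatio a p x (i.1 + 1) * (a ^ 2 * p) ^ (i.1 + 1) *
    qGaussTerm a⁻¹ p (a ^ 2 * p) (2 * i.1 + 1) i.2

lemma inv_mul_sq_mul (ha : a ≠ 0) (p : ℂ) : a⁻¹ * (a ^ 2 * p) = a * p := by field_simp

lemma summable_transformationTerm (hp0 : p ≠ 0) (hp : ‖p‖ < 1) (ha : a ∈ wellPoisedDomain p)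
    (hz : ‖a ^ 2 * p‖ < 1) (hx : ‖x‖ ≤ 1) : Summable (transformationTerm a p x) := by
  have hapx := norm_mul_mul_lt_one_of_mem_wellPoisedDomain hp0 ha hx
  have ha1 : (1 : ℂ) ∉ ({a} : Set ℂ) := by
    rintro rfl
    simpa using ha.1
  have hby (j : ℕ) : a⁻¹ * (a ^ 2 * p) * p ^ j ≠ 1 := by
    rw [inv_mul_sq_mul (ne_zero_of_mem_wellPoisedDomain ha)]
    exact mul_mul_pow_ne_one (mul_pow_ne_one_of_mem_wellPoisedDomain hp0 hp ha) j
  obtain ⟨B, hB, hB'⟩ := exists_norm_veryWellPoised_le hp isCompact_singleton ha1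
  obtain ⟨C, hC, hC'⟩ := exists_norm_wellPoisedRatio_le hp (isCompact_singleton (x := a * p * x))
    (by simpa using mul_pow_ne_one_of_norm_lt_one hp hapx) one_pos
  obtain ⟨D, -, hD'⟩ := exists_norm_qGaussTerm_le hp hby
  have hg := summable_geometric_of_lt_one (norm_nonneg (a ^ 2 * p)) hz
  refine .of_norm_bounded ((((summable_nat_add_iff 1).2 hg).mul_of_nonneg hg
    (fun _ => by positivity) fun _ => by positivity).mul_left (B * C * D)) fun i => ?_
  calc ‖transformationTerm a p x i‖
      ≤ B * (C * 1 ^ (i.1 + 1)) * ‖a ^ 2 * p‖ ^ (i.1 + 1) * (D * ‖a ^ 2 * p‖ ^ i.2) := by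
        rw [transformationTerm, norm_mul, norm_mul, norm_mul, norm_pow]
        gcongr
        exacts [hB' a rfl _, hC' a x rfl hx _, hD' _ _]
    _ = B * C * D * (‖a ^ 2 * p‖ ^ (i.1 + 1) * ‖a ^ 2 * p‖ ^ i.2) := by ring

lemma hasSum_transformationTerm_row (hp0 : p ≠ 0) (hp : ‖p‖ < 1) (ha : a ∈ wellPoisedDomain p)
    (hz : ‖a ^ 2 * p‖ < 1) (x : ℂ) (k : ℕ) :
    HasSum (fun m => transformationTerm a p x (k, m)) (veryWellPoisedTerm a p x k) := by
  have hby (j : ℕ) : a⁻¹ * (a ^ 2 * p) * p ^ j ≠ 1 := by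
    rw [inv_mul_sq_mul (ne_zero_of_mem_wellPoisedDomain ha)]
    exact mul_mul_pow_ne_one (mul_pow_ne_one_of_mem_wellPoisedDomain hp0 hp ha) j
  have hsum := (hasSum_qGaussTerm hp hz hby (2 * k + 1)).mul_left
    (veryWellPoised a p (k + 1) * wellPoisedRatio a p x (k + 1) * (a ^ 2 * p) ^ (k + 1))
  rwa [mul_right_comm _ (_ ^ _) (_ / _)] at hsum

lemma wellPoisedTerm_eq_add_sum (hp0 : p ≠ 0) (hp : ‖p‖ < 1) (ha : a ∈ wellPoisedDomain p)
    (hx : ‖x‖ ≤ 1) (n : ℕ) :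
    wellPoisedTerm a p x n = qGaussDeriv a⁻¹ p (a ^ 2 * p) n +
      ∑ i ∈ antidiagonal n, transformationTerm a p x i := by
  have ha0 := ne_zero_of_mem_wellPoisedDomain ha
  rw [wellPoisedTerm, qPochHom_succ_div_eq_sum ha0 hp0 (mul_pow_ne_one_of_norm_lt_one hp hp)
    (mul_pow_ne_one_of_mem_wellPoisedDomain hp0 hp ha) (mul_pow_ne_one_of_norm_lt_one hp
      (norm_mul_mul_lt_one_of_mem_wellPoisedDomain hp0 ha hx)) (mul_pow_ne_one_of_norm_lt_one hp
      (norm_inv_lt_one_of_mem_wellPoisedDomain ha)), add_mul, qGaussDeriv, inv_mul_sq_mul ha0,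
    Nat.sum_antidiagonal_eq_sum_range_succ_mk, sum_mul]
  congr 1
  refine sum_congr rfl fun k hk => ?_
  have hpow : (a ^ 2 * p) ^ (n + 1) = (a ^ 2 * p) ^ (k + 1) * (a ^ 2 * p) ^ (n - k) := by
    rw [← pow_add, add_right_comm, Nat.add_sub_of_le (Nat.lt_succ_iff.1 (mem_range.1 hk))]
  rw [transformationTerm, qGaussTerm, inv_mul_sq_mul ha0, hpow]
  ring

lemma hasSum_wellPoisedTerm_of_norm_lt_one (hp0 : p ≠ 0) (hp : ‖p‖ < 1)
    (ha : a ∈ wellPoisedDomain p) (hz : ‖a ^ 2 * p‖ < 1) (hx : ‖x‖ ≤ 1) :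
    HasSum (wellPoisedTerm a p x)
      (∑' i, lambertDiff (a ^ 2 * p) (a * p) p i + ∑' k, veryWellPoisedTerm a p x k) := by
  have hby := inv_mul_sq_mul (ne_zero_of_mem_wellPoisedDomain ha) p
  have hlambert := hasSum_qGaussDeriv hp hz
    (by rw [hby]; exact norm_mul_lt_one_of_mem_wellPoisedDomain hp0 ha)
  have hF := (summable_transformationTerm hp0 hp ha hz hx).hasSum
  have hrows := hF.prod_fiberwise (hasSum_transformationTerm_row hp0 hp ha hz x)
  have hdiag := (HasAntidiagonal.sigmaAntidiagonalEquivProd.hasSum_iff.2 hF).sigma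
    fun n => hasSum_fintype _
  have hsum := hlambert.add hdiag
  rw [hby, ← hrows.tsum_eq] at hsum
  refine hsum.congr_fun fun n => ?_
  rw [wellPoisedTerm_eq_add_sum hp0 hp ha hx, ← sum_attach, univ_eq_attach]
  rfl

end transformation

section boundary

variable {a p x : ℂ} {K : Set ℂ} {s : ℝ}

lemma exists_norm_veryWellPoisedTerm_le (hp0 : p ≠ 0) (hp : ‖p‖ < 1) (hK : IsCompact K)
    (hKD : K ⊆ wellPoisedDomain p) (hs0 : 0 < s) (hs1 : s ≤ 1) (hx : ‖x‖ ≤ s) :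
    ∃ C > 0, ∀ a ∈ K, ∀ k, ‖veryWellPoisedTerm a p x k‖ ≤ C * s ^ (k + 1) := by
  have h1K : (1 : ℂ) ∉ K := fun h => by simpa using (hKD h).1
  obtain ⟨A, hA, hA'⟩ := exists_norm_veryWellPoised_le hp hK h1K
  obtain ⟨B, hB, hB'⟩ := exists_norm_wellPoisedRatio_le hp
    (hK.image (f := fun a => a * p * x) (by fun_prop)) (Set.forall_mem_image.2 fun a ha =>
      mul_pow_ne_one_of_norm_lt_one hp
        (norm_mul_mul_lt_one_of_mem_wellPoisedDomain hp0 (hKD ha) (hx.trans hs1))) hs0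
  obtain ⟨C, hC, hC'⟩ := exists_norm_qPoch_le hp ‖p‖
  obtain ⟨D, hD, hD'⟩ := exists_norm_qPoch_inv_le hp
    (hK.image (f := fun a => a ^ 2 * p) (by fun_prop)) (Set.forall_mem_image.2 fun a ha =>
      sq_mul_mul_pow_ne_one_of_mem_wellPoisedDomain hp (hKD ha))
  refine ⟨A * B * (C * D), by positivity, fun a ha k => ?_⟩
  calc ‖veryWellPoisedTerm a p x k‖ ≤ A * (B * s ^ (k + 1)) * (C * D) * 1 := by
        rw [veryWellPoisedTerm, div_eq_mul_inv]
        simp only [norm_mul, norm_pow _ (k + 1)]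
        gcongr
        exacts [hA' a ha _, hB' a x ⟨a, ha, rfl⟩ hx _, hC' p le_rfl _, hD' _ ⟨a, ha, rfl⟩ _,
          pow_le_one₀ (by positivity) (by simpa using (hKD ha).2.1)]
    _ = A * B * (C * D) * s ^ (k + 1) := by ring

lemma exists_norm_wellPoisedTerm_le (hp0 : p ≠ 0) (hp : ‖p‖ < 1) (hK : IsCompact K)
    (hKD : K ⊆ wellPoisedDomain p) (hs0 : 0 < s) (hs1 : s ≤ 1) (hx : ‖x‖ ≤ s) :
    ∃ C > 0, ∀ a ∈ K, ∀ n, ‖wellPoisedTerm a p x n‖ ≤ C * s ^ (n + 1) := by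
  obtain ⟨A, hA, hA'⟩ := exists_norm_qPochHom_le hp 1 hs0
  obtain ⟨B, hB, hB'⟩ := exists_norm_qPoch_inv_le hp
    (hK.image (f := fun a => a * p * x) (by fun_prop)) (Set.forall_mem_image.2 fun a ha =>
      mul_pow_ne_one_of_norm_lt_one hp
        (norm_mul_mul_lt_one_of_mem_wellPoisedDomain hp0 (hKD ha) (hx.trans hs1)))
  have := sub_pos.2 hp
  refine ⟨A * (B * (1 - ‖p‖)⁻¹), by positivity, fun a ha n => ?_⟩
  calc ‖wellPoisedTerm a p x n‖ ≤ A * s ^ (n + 1) * (B * (1 - ‖p‖)⁻¹) * 1 := by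
        rw [wellPoisedTerm, div_eq_mul_inv, mul_inv]
        simp only [norm_mul, norm_pow _ (n + 1)]
        gcongr
        exacts [hA' _ x (norm_inv_lt_one_of_mem_wellPoisedDomain (hKD ha)).le hx _,
          hB' _ ⟨a, ha, rfl⟩ _, norm_one_sub_pow_succ_inv_le hp n,
          pow_le_one₀ (by positivity) (by simpa using (hKD ha).2.1)]
    _ = A * (B * (1 - ‖p‖)⁻¹) * s ^ (n + 1) := by ring

lemma summable_mul_pow_succ (C : ℝ) (hs0 : 0 < s) (hs1 : s < 1) :
    Summable fun n : ℕ => C * s ^ (n + 1) :=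
  ((summable_nat_add_iff 1).2 (summable_geometric_of_lt_one hs0.le hs1)).mul_left C

lemma continuousOn_veryWellPoisedTerm (hp0 : p ≠ 0) (hp : ‖p‖ < 1) (hx : ‖x‖ ≤ 1) (k : ℕ) :
    ContinuousOn (fun a => veryWellPoisedTerm a p x k) (wellPoisedDomain p) := by
  have hpp := qPoch_ne_zero (mul_pow_ne_one_of_norm_lt_one hp hp) (k + 1)
  refine .mul (.mul (.mul (.div (by fun_prop) (by fun_prop) fun a ha => mul_ne_zero ?_ hpp)
    (.div (by fun_prop) (by fun_prop) fun a ha => ?_))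
    (.div (by fun_prop) (by fun_prop) fun a ha => ?_)) (by fun_prop)
  · exact sub_ne_zero.2 (by simpa using (mul_pow_ne_one_of_mem_wellPoisedDomain hp0 hp ha 0).symm)
  · exact qPoch_ne_zero (mul_pow_ne_one_of_norm_lt_one hp
      (norm_mul_mul_lt_one_of_mem_wellPoisedDomain hp0 ha hx)) _
  · exact qPoch_ne_zero (sq_mul_mul_pow_ne_one_of_mem_wellPoisedDomain hp ha) _

lemma continuousOn_wellPoisedTerm (hp0 : p ≠ 0) (hp : ‖p‖ < 1) (hx : ‖x‖ ≤ 1) (n : ℕ) :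
    ContinuousOn (fun a => wellPoisedTerm a p x n) (wellPoisedDomain p) := by
  refine .mul (.div ?_ (by fun_prop) fun a ha => mul_ne_zero ?_ (one_sub_pow_succ_ne_zero hp n))
    (by fun_prop)
  · unfold qPochHom
    fun_prop (disch := exact fun _ => ne_zero_of_mem_wellPoisedDomain)
  · exact qPoch_ne_zero (mul_pow_ne_one_of_norm_lt_one hp
      (norm_mul_mul_lt_one_of_mem_wellPoisedDomain hp0 ha hx)) _

lemma continuousOn_lambertDiff (hp0 : p ≠ 0) (hp : ‖p‖ < 1) (i : ℕ) :
    ContinuousOn (fun a => lambertDiff (a ^ 2 * p) (a * p) p i) (wellPoisedDomain p) := by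
  refine .sub (.div (by fun_prop) (by fun_prop) fun a ha => sub_ne_zero.2 ?_)
    (.div (by fun_prop) (by fun_prop) fun a ha => sub_ne_zero.2 ?_)
  · exact (sq_mul_mul_pow_ne_one_of_mem_wellPoisedDomain hp ha i).symm
  · exact (mul_pow_ne_one_of_norm_lt_one hp
      (norm_mul_lt_one_of_mem_wellPoisedDomain hp0 ha) i).symm

lemma continuousOn_tsum_veryWellPoisedTerm (hp0 : p ≠ 0) (hp : ‖p‖ < 1) (hK : IsCompact K)
    (hKD : K ⊆ wellPoisedDomain p) (hx : ‖x‖ < 1) :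
    ContinuousOn (fun a => ∑' k, veryWellPoisedTerm a p x k) K := by
  obtain ⟨s, hxs, hs1⟩ := exists_between hx
  have hs0 := (norm_nonneg x).trans_lt hxs
  obtain ⟨C, -, hC⟩ := exists_norm_veryWellPoisedTerm_le hp0 hp hK hKD hs0 hs1.le hxs.le
  exact continuousOn_tsum (fun k => (continuousOn_veryWellPoisedTerm hp0 hp hx.le k).mono hKD)
    (summable_mul_pow_succ C hs0 hs1) fun k a ha => hC a ha k

lemma continuousOn_tsum_wellPoisedTerm (hp0 : p ≠ 0) (hp : ‖p‖ < 1) (hK : IsCompact K)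
    (hKD : K ⊆ wellPoisedDomain p) (hx : ‖x‖ < 1) :
    ContinuousOn (fun a => ∑' n, wellPoisedTerm a p x n) K := by
  obtain ⟨s, hxs, hs1⟩ := exists_between hx
  have hs0 := (norm_nonneg x).trans_lt hxs
  obtain ⟨C, -, hC⟩ := exists_norm_wellPoisedTerm_le hp0 hp hK hKD hs0 hs1.le hxs.le
  exact continuousOn_tsum (fun n => (continuousOn_wellPoisedTerm hp0 hp hx.le n).mono hKD)
    (summable_mul_pow_succ C hs0 hs1) fun n a ha => hC a ha n

lemma continuousOn_tsum_lambertDiff (hp0 : p ≠ 0) (hp : ‖p‖ < 1) (hK : IsCompact K)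
    (hKD : K ⊆ wellPoisedDomain p) :
    ContinuousOn (fun a => ∑' i, lambertDiff (a ^ 2 * p) (a * p) p i) K := by
  obtain ⟨C, -, hC⟩ := exists_norm_lambertDiff_le hp
    (hK.image (f := fun a => a ^ 2 * p) (by fun_prop))
    (hK.image (f := fun a => a * p) (by fun_prop))
    (Set.forall_mem_image.2 fun a ha => sq_mul_mul_pow_ne_one_of_mem_wellPoisedDomain hp (hKD ha))
    (Set.forall_mem_image.2 fun a ha => mul_pow_ne_one_of_norm_lt_one hp
      (norm_mul_lt_one_of_mem_wellPoisedDomain hp0 (hKD ha)))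
  exact continuousOn_tsum (fun i => (continuousOn_lambertDiff hp0 hp i).mono hKD)
    ((summable_geometric_of_lt_one (norm_nonneg p) hp).mul_left C)
    fun i a ha => hC _ ⟨a, ha, rfl⟩ _ ⟨a, ha, rfl⟩ i

lemma summable_veryWellPoisedTerm (hp0 : p ≠ 0) (hp : ‖p‖ < 1) (ha : a ∈ wellPoisedDomain p)
    (hx : ‖x‖ < 1) : Summable (veryWellPoisedTerm a p x) := by
  obtain ⟨s, hxs, hs1⟩ := exists_between hx
  have hs0 := (norm_nonneg x).trans_lt hxs
  obtain ⟨C, -, hC⟩ := exists_norm_veryWellPoisedTerm_le hp0 hp isCompact_singleton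
    (Set.singleton_subset_iff.2 ha) hs0 hs1.le hxs.le
  exact .of_norm_bounded (summable_mul_pow_succ C hs0 hs1) (hC a rfl)

lemma summable_wellPoisedTerm (hp0 : p ≠ 0) (hp : ‖p‖ < 1) (ha : a ∈ wellPoisedDomain p)
    (hx : ‖x‖ < 1) : Summable (wellPoisedTerm a p x) := by
  obtain ⟨s, hxs, hs1⟩ := exists_between hx
  have hs0 := (norm_nonneg x).trans_lt hxs
  obtain ⟨C, -, hC⟩ := exists_norm_wellPoisedTerm_le hp0 hp isCompact_singleton
    (Set.singleton_subset_iff.2 ha) hs0 hs1.le hxs.le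
  exact .of_norm_bounded (summable_mul_pow_succ C hs0 hs1) (hC a rfl)

lemma norm_smul_sq_mul_lt_one (ha : a ∈ wellPoisedDomain p) {t : ℝ} (ht0 : 0 ≤ t) (ht1 : t < 1) :
    ‖(t • a) ^ 2 * p‖ < 1 := by
  rw [smul_pow, smul_mul_assoc, norm_smul, norm_pow, Real.norm_of_nonneg ht0]
  exact mul_lt_one_of_nonneg_of_lt_one_left (sq_nonneg t) (pow_lt_one₀ ht0 ht1 two_ne_zero) ha.2.1

lemma smul_mem_wellPoisedDomain (ha : a ∈ wellPoisedDomain p) {t : ℝ} (ht0 : ‖a‖⁻¹ < t)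
    (ht1 : t ≤ 1) : t • a ∈ wellPoisedDomain p := by
  have ht : 0 < t := (inv_nonneg.2 (norm_nonneg a)).trans_lt ht0
  rcases ht1.eq_or_lt with rfl | ht1
  · rwa [one_smul]
  have hz := norm_smul_sq_mul_lt_one ha ht.le ht1
  refine ⟨?_, hz.le, fun h => hz.ne (by rw [h, norm_one])⟩
  rw [norm_smul, Real.norm_of_nonneg ht.le]
  exact (inv_lt_iff_one_lt_mul₀ (one_pos.trans ha.1)).1 ht0

/-- Both sides are continuous in `a` along the segment `[r, 1] • a`, which meets the boundary
`|a² p| = 1` of the domain at most at its endpoint. -/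
theorem tsum_wellPoisedTerm (hp0 : p ≠ 0) (hp : ‖p‖ < 1) (ha : a ∈ wellPoisedDomain p)
    (hx : ‖x‖ < 1) :
    ∑' n, wellPoisedTerm a p x n =
      ∑' i, lambertDiff (a ^ 2 * p) (a * p) p i + ∑' k, veryWellPoisedTerm a p x k := by
  obtain ⟨r, hr, hr1⟩ := exists_between (inv_lt_one_of_one_lt₀ ha.1)
  have hr0 : 0 ≤ r := (inv_nonneg.2 (norm_nonneg a)).trans hr.le
  have hmem : (fun t : ℝ => t • a) '' Set.Icc r 1 ⊆ wellPoisedDomain p :=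
    Set.image_subset_iff.2 fun t ht => smul_mem_wellPoisedDomain ha (hr.trans_le ht.1) ht.2
  have hK : IsCompact ((fun t : ℝ => t • a) '' Set.Icc r 1) :=
    isCompact_Icc.image (by fun_prop)
  have heq : Set.EqOn (fun a => ∑' n, wellPoisedTerm a p x n) (fun a =>
      ∑' i, lambertDiff (a ^ 2 * p) (a * p) p i + ∑' k, veryWellPoisedTerm a p x k)
      ((fun t : ℝ => t • a) '' Set.Ico r 1) := by
    rintro _ ⟨t, ht, rfl⟩
    exact (hasSum_wellPoisedTerm_of_norm_lt_one hp0 hp (hmem ⟨t, Set.Ico_subset_Icc_self ht, rfl⟩)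
      (norm_smul_sq_mul_lt_one ha (hr0.trans ht.1) ht.2) hx.le).tsum_eq
  refine heq.of_subset_closure (continuousOn_tsum_wellPoisedTerm hp0 hp hK hmem hx)
    ((continuousOn_tsum_lambertDiff hp0 hp hK hmem).add
      (continuousOn_tsum_veryWellPoisedTerm hp0 hp hK hmem hx))
    (Set.image_mono Set.Ico_subset_Icc_self) ?_ ⟨1, ⟨hr1.le, le_rfl⟩, one_smul ℝ a⟩
  rw [← closure_Ico hr1.ne]
  exact image_closure_subset_closure_image (by fun_prop)

end boundary

section specialization

variable {ε q ρ x : ℂ}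

lemma norm_inv_lt_one_of_one_lt_norm (hρ : 1 < ‖ρ‖) : ‖ρ⁻¹‖ < 1 := by
  rw [norm_inv]; exact inv_lt_one_of_one_lt₀ hρ

lemma div_sq_mul_sq_eq_neg_one (hq0 : q ≠ 0) (hε : ε ^ 2 = -1) : (ε / q) ^ 2 * q ^ 2 = -1 := by
  rw [← mul_pow, div_mul_cancel₀ _ hq0, hε]

lemma inv_div_eq_neg_mul (hε : ε ^ 2 = -1) : (ε / q)⁻¹ = -ε * q := by
  have hε0 : ε ≠ 0 := by rintro rfl; norm_num at hε
  rw [inv_div, div_eq_iff hε0]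
  linear_combination q * hε

lemma div_mul_sq (hq0 : q ≠ 0) : ε / q * q ^ 2 = ε * q := by field_simp

lemma norm_eq_one_of_sq_eq_neg_one (hε : ε ^ 2 = -1) : ‖ε‖ = 1 := by
  rw [← pow_eq_one_iff_of_nonneg (norm_nonneg ε) two_ne_zero, ← norm_pow, hε, norm_neg, norm_one]

lemma div_mem_wellPoisedDomain (hq0 : q ≠ 0) (hq : ‖q‖ < 1) (hε : ε ^ 2 = -1) :
    ε / q ∈ wellPoisedDomain (q ^ 2) := by
  refine ⟨?_, ?_, ?_⟩
  · rw [norm_div, norm_eq_one_of_sq_eq_neg_one hε, one_div]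
    exact (one_lt_inv₀ (norm_pos_iff.2 hq0)).2 hq
  · rw [div_sq_mul_sq_eq_neg_one hq0 hε, norm_neg, norm_one]
  · rw [div_sq_mul_sq_eq_neg_one hq0 hε]
    norm_num

lemma veryWellPoisedTerm_div (hq0 : q ≠ 0) (hε : ε ^ 2 = -1) (x : ℂ) (n : ℕ) :
    veryWellPoisedTerm (ε / q) (q ^ 2) x n =
      (1 - ε * q ^ (4 * (n + 1) - 1)) * qPoch (ε / q) (q ^ 2) (n + 1) *
        wellPoisedRatio (ε / q) (q ^ 2) x (n + 1) *
        qPoch (q ^ 2) (q ^ 2) (2 * (n + 1) - 1) * (-1) ^ (n + 1) /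
      ((1 - ε / q) * qPoch (q ^ 2) (q ^ 2) (n + 1) * qPoch (-1) (q ^ 2) (2 * (n + 1))) := by
  have hpow : ε / q * (q ^ 2) ^ (2 * (n + 1)) = ε * q ^ (4 * (n + 1) - 1) := by
    rw [← pow_mul, show 2 * (2 * (n + 1)) = 4 * (n + 1) - 1 + 1 by omega, pow_succ]
    field_simp
  rw [veryWellPoisedTerm, veryWellPoised, hpow, div_sq_mul_sq_eq_neg_one hq0 hε,
    show 2 * (n + 1) - 1 = 2 * n + 1 by omega, show 2 * (n + 1) = 2 * n + 2 by ring]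
  simp only [div_eq_mul_inv, mul_inv]
  ring

lemma veryWellPoisedTerm_div_inv (hq0 : q ≠ 0) (hε : ε ^ 2 = -1) (hρ : ρ ≠ 0) (n : ℕ) :
    veryWellPoisedTerm (ε / q) (q ^ 2) ρ⁻¹ n =
      ((1 - ε * q ^ (4 * (n + 1) - 1)) *
        (qPoch (ε / q) (q ^ 2) (n + 1) * qPoch ρ (q ^ 2) (n + 1)) *
        qPoch (q ^ 2) (q ^ 2) (2 * (n + 1) - 1) * (-1) ^ (n + 1)) /
      ((1 - ε / q) * (qPoch (ε * q / ρ) (q ^ 2) (n + 1) * qPoch (q ^ 2) (q ^ 2) (n + 1)) *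
        qPoch (-1) (q ^ 2) (2 * (n + 1)) * ρ ^ (n + 1)) := by
  rw [veryWellPoisedTerm_div hq0 hε, wellPoisedRatio, qPochHom_inv hρ, one_mul, div_mul_sq hq0,
    ← div_eq_mul_inv (ε * q)]
  simp only [div_eq_mul_inv, mul_inv]
  ring

lemma veryWellPoisedTerm_div_inv_self (hq0 : q ≠ 0) (hε : ε ^ 2 = -1) (n : ℕ) :
    veryWellPoisedTerm (ε / q) (q ^ 2) (ε / q)⁻¹ n =
      ((1 - ε * q ^ (4 * (n + 1) - 1)) *
        (qPoch (ε / q) (q ^ 2) (n + 1) * qPoch (ε / q) (q ^ 2) (n + 1)) *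
        qPoch (q ^ 2) (q ^ 2) (2 * (n + 1) - 1) * (ε * q) ^ (n + 1)) /
      ((1 - ε / q) * (qPoch (q ^ 2) (q ^ 2) (n + 1) * qPoch (q ^ 2) (q ^ 2) (n + 1)) *
        qPoch (-1) (q ^ 2) (2 * (n + 1))) := by
  have hε0 : ε ≠ 0 := by rintro rfl; norm_num at hε
  have hbase : ε * q / (ε / q) = q ^ 2 := by field_simp
  have hpow : (ε * q) ^ (n + 1) = (-1) ^ (n + 1) / (ε / q) ^ (n + 1) := by
    rw [← div_pow, neg_div, one_div, inv_div_eq_neg_mul hε, neg_mul, neg_neg]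
  rw [veryWellPoisedTerm_div_inv hq0 hε (div_ne_zero hε0 hq0), hbase, hpow]
  generalize ε / q = a
  simp only [div_eq_mul_inv, mul_inv]
  ring

lemma veryWellPoisedTerm_div_zero (hq0 : q ≠ 0) (hε : ε ^ 2 = -1) (n : ℕ) :
    veryWellPoisedTerm (ε / q) (q ^ 2) 0 n =
      ((1 - ε * q ^ (4 * (n + 1) - 1)) * qPoch (ε / q) (q ^ 2) (n + 1) *
        qPoch (q ^ 2) (q ^ 2) (2 * (n + 1) - 1) * q ^ ((n + 1) ^ 2 - (n + 1))) /
      ((1 - ε / q) * qPoch (q ^ 2) (q ^ 2) (n + 1) * qPoch (-1) (q ^ 2) (2 * (n + 1))) := by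
  have hsign : (-1 : ℂ) ^ (n + 1) * (-1) ^ (n + 1) = 1 := by rw [← mul_pow]; norm_num
  rw [veryWellPoisedTerm_div hq0 hε, wellPoisedRatio_zero_right]
  congr 1
  linear_combination (1 - ε * q ^ (4 * (n + 1) - 1)) * qPoch (ε / q) (q ^ 2) (n + 1) *
    qPoch (q ^ 2) (q ^ 2) (2 * (n + 1) - 1) * q ^ ((n + 1) ^ 2 - (n + 1)) * hsign

lemma wellPoisedTerm_div_inv (hq0 : q ≠ 0) (hε : ε ^ 2 = -1) (hρ : ρ ≠ 0) (n : ℕ) :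
    wellPoisedTerm (ε / q) (q ^ 2) ρ⁻¹ n =
      (qPoch (-ε * ρ * q) (q ^ 2) (n + 1) * (-1) ^ (n + 1)) /
      (qPoch (ε * q / ρ) (q ^ 2) (n + 1) * (1 - q ^ (2 * (n + 1))) * ρ ^ (n + 1)) := by
  rw [wellPoisedTerm, qPochHom_inv hρ, inv_div_eq_neg_mul hε, div_mul_sq hq0,
    div_sq_mul_sq_eq_neg_one hq0 hε, ← pow_mul, mul_right_comm, ← div_eq_mul_inv (ε * q)]
  simp only [div_eq_mul_inv, mul_inv]
  ring

lemma wellPoisedTerm_inv_self (a p : ℂ) (n : ℕ) : wellPoisedTerm a p a⁻¹ n = 0 := by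
  rw [wellPoisedTerm, qPochHom, prod_eq_zero (mem_range.2 n.succ_pos) (by simp), zero_div, zero_mul]

lemma wellPoisedTerm_div_zero (hq0 : q ≠ 0) (hε : ε ^ 2 = -1) (n : ℕ) :
    wellPoisedTerm (ε / q) (q ^ 2) 0 n =
      (-ε * q) ^ (n + 1) * q ^ ((n + 1) ^ 2 - (n + 1)) / (1 - q ^ (2 * (n + 1))) := by
  rw [wellPoisedTerm, qPochHom_zero_right, inv_div_eq_neg_mul hε, mul_zero, qPoch,
    prod_eq_one (by simp), one_mul, div_sq_mul_sq_eq_neg_one hq0 hε, ← pow_mul, div_mul_eq_mul_div,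
    mul_right_comm, ← mul_pow, mul_neg_one, neg_neg]

lemma wellPoisedTerm_div_zero_sub (hq0 : q ≠ 0) (hε : ε ^ 2 = -1) (n : ℕ) :
    wellPoisedTerm (-ε / q) (q ^ 2) 0 (2 * n) - wellPoisedTerm (ε / q) (q ^ 2) 0 (2 * n) =
      2 * ε * q * ((-1) ^ n * q ^ (4 * n ^ 2 + 4 * n) / (1 - q ^ (4 * n + 2))) := by
  have hexp : (2 * n + 1) ^ 2 - (2 * n + 1) = 4 * n ^ 2 + 2 * n :=
    Nat.sub_eq_of_eq_add (by ring)
  rw [wellPoisedTerm_div_zero hq0 (by rwa [neg_sq]), wellPoisedTerm_div_zero hq0 hε, neg_neg, hexp,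
    neg_mul, Odd.neg_pow ⟨n, rfl⟩, mul_pow, pow_succ ε, pow_mul ε, hε]
  ring

/-- The Lambert series `∑ ((-q²ⁱ) / (1 + q²ⁱ) - (ε q²ⁱ⁺¹) / (1 - ε q²ⁱ⁺¹))` to which
`tsum_wellPoisedTerm` specializes at `a = ε / q`, in base `q ^ 2`, when `ε ^ 2 = -1`. -/
noncomputable def lambertSum (ε q : ℂ) : ℂ :=
  ∑' i, lambertDiff (-1) (ε * q) (q ^ 2) i

lemma tsum_wellPoisedTerm_div (hq0 : q ≠ 0) (hq : ‖q‖ < 1) (hε : ε ^ 2 = -1) (hx : ‖x‖ < 1) :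
    ∑' n, wellPoisedTerm (ε / q) (q ^ 2) x n =
      lambertSum ε q + ∑' k, veryWellPoisedTerm (ε / q) (q ^ 2) x k := by
  rw [tsum_wellPoisedTerm (pow_ne_zero 2 hq0) (norm_sq_lt_one hq)
    (div_mem_wellPoisedDomain hq0 hq hε) hx, div_sq_mul_sq_eq_neg_one hq0 hε, div_mul_sq hq0,
    lambertSum]

lemma hasSum_veryWellPoisedTerm_div (hq0 : q ≠ 0) (hq : ‖q‖ < 1) (hε : ε ^ 2 = -1)
    (hx : ‖x‖ < 1) : HasSum (veryWellPoisedTerm (ε / q) (q ^ 2) x)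
      (∑' k, veryWellPoisedTerm (ε / q) (q ^ 2) x k) :=
  (summable_veryWellPoisedTerm (pow_ne_zero 2 hq0) (norm_sq_lt_one hq)
    (div_mem_wellPoisedDomain hq0 hq hε) hx).hasSum

lemma hasSum_wellPoisedTerm_div (hq0 : q ≠ 0) (hq : ‖q‖ < 1) (hε : ε ^ 2 = -1) (hx : ‖x‖ < 1) :
    HasSum (wellPoisedTerm (ε / q) (q ^ 2) x)
      (lambertSum ε q + ∑' k, veryWellPoisedTerm (ε / q) (q ^ 2) x k) := by
  rw [← tsum_wellPoisedTerm_div hq0 hq hε hx]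
  exact (summable_wellPoisedTerm (pow_ne_zero 2 hq0) (norm_sq_lt_one hq)
    (div_mem_wellPoisedDomain hq0 hq hε) hx).hasSum

lemma summable_lambertDiff_neg_one (hq0 : q ≠ 0) (hq : ‖q‖ < 1) (hε : ε ^ 2 = -1) :
    Summable (lambertDiff (-1) (ε * q) (q ^ 2)) := by
  have ha := div_mem_wellPoisedDomain hq0 hq hε
  have hp := norm_sq_lt_one hq
  simpa only [div_sq_mul_sq_eq_neg_one hq0 hε, div_mul_sq hq0] using
    summable_lambertDiff hp (sq_mul_mul_pow_ne_one_of_mem_wellPoisedDomain hp ha)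
      (mul_pow_ne_one_of_norm_lt_one hp
        (norm_mul_lt_one_of_mem_wellPoisedDomain (pow_ne_zero 2 hq0) ha))

lemma one_sub_mul_sq_pow_ne_zero (hq : ‖q‖ < 1) (hε : ε ^ 2 = -1) (i : ℕ) :
    1 - ε * q * (q ^ 2) ^ i ≠ 0 := by
  refine sub_ne_zero.2 (mul_pow_ne_one_of_norm_lt_one (norm_sq_lt_one hq) ?_ i).symm
  rwa [norm_mul, norm_eq_one_of_sq_eq_neg_one hε, one_mul]

theorem lambertSum_neg_sub (hq0 : q ≠ 0) (hq : ‖q‖ < 1) (hε : ε ^ 2 = -1) :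
    lambertSum (-ε) q - lambertSum ε q = 2 * ε * q * ramanujanPsi (q ^ 4) ^ 2 := by
  have hpsi := (hasSum_ramanujanPsi_sq (pow_ne_zero 2 hq0) (norm_sq_lt_one hq)).mul_left
    (2 * ε * q)
  rw [← pow_mul q 2 2] at hpsi
  rw [lambertSum, lambertSum, ← (summable_lambertDiff_neg_one hq0 hq (by rwa [neg_sq])).tsum_sub
    (summable_lambertDiff_neg_one hq0 hq hε), ← hpsi.tsum_eq]
  refine tsum_congr fun i => ?_
  have hsub := one_sub_mul_sq_pow_ne_zero hq hε i
  have hadd := one_sub_mul_sq_pow_ne_zero hq (neg_sq ε ▸ hε) i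
  rw [neg_mul, neg_mul, sub_neg_eq_add] at hadd
  have hprod : 1 + (q ^ 2) ^ (2 * i + 1) =
      (1 + ε * q * (q ^ 2) ^ i) * (1 - ε * q * (q ^ 2) ^ i) := by
    linear_combination q ^ 2 * ((q ^ 2) ^ i) ^ 2 * hε
  rw [lambertDiff, lambertDiff, sub_sub_sub_cancel_left, neg_mul, neg_mul, sub_neg_eq_add, hprod,
    ← mul_div_assoc, mul_assoc (2 * ε), mul_assoc 2, ← mul_assoc ε]
  generalize ε * q * (q ^ 2) ^ i = t at *
  rw [div_sub_div _ _ hsub hadd, mul_comm (1 + t)]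
  ring

/-- At `x = a⁻¹` every `wellPoisedTerm` vanishes, leaving the Lambert series alone. -/
theorem hasSum_veryWellPoised_self (hq0 : q ≠ 0) (hq : ‖q‖ < 1) (hε : ε ^ 2 = -1) :
    HasSum (fun n : ℕ+ =>
      ((1 - ε * q ^ (4 * (n : ℕ) - 1)) * (qPoch (ε / q) (q ^ 2) n * qPoch (ε / q) (q ^ 2) n) *
          qPoch (q ^ 2) (q ^ 2) (2 * (n : ℕ) - 1) * (ε * q) ^ (n : ℕ)) /
        ((1 - ε / q) * (qPoch (q ^ 2) (q ^ 2) n * qPoch (q ^ 2) (q ^ 2) n) *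
          qPoch (-1) (q ^ 2) (2 * (n : ℕ)))) (-lambertSum ε q) := by
  have hx : ‖(ε / q)⁻¹‖ < 1 := by
    rwa [inv_div_eq_neg_mul hε, norm_mul, norm_neg, norm_eq_one_of_sq_eq_neg_one hε, one_mul]
  have hzero := tsum_wellPoisedTerm_div hq0 hq hε hx
  simp only [wellPoisedTerm_inv_self, tsum_zero] at hzero
  have h := hasSum_veryWellPoisedTerm_div hq0 hq hε hx
  rw [← neg_eq_of_add_eq_zero_right hzero.symm] at h
  exact Equiv.pnatEquivNat.symm.hasSum_iff.1
    (h.congr_fun fun n => (veryWellPoisedTerm_div_inv_self hq0 hε n).symm)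

theorem hasSum_veryWellPoised_inv (hq0 : q ≠ 0) (hq : ‖q‖ < 1) (hε : ε ^ 2 = -1)
    (hρ : 1 < ‖ρ‖) :
    HasSum (fun n : ℕ+ =>
      ((1 - ε * q ^ (4 * (n : ℕ) - 1)) * (qPoch (ε / q) (q ^ 2) n * qPoch ρ (q ^ 2) n) *
          qPoch (q ^ 2) (q ^ 2) (2 * (n : ℕ) - 1) * (-1) ^ (n : ℕ)) /
        ((1 - ε / q) * (qPoch (ε * q / ρ) (q ^ 2) n * qPoch (q ^ 2) (q ^ 2) n) *
          qPoch (-1) (q ^ 2) (2 * (n : ℕ)) * ρ ^ (n : ℕ)))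
      (∑' k, veryWellPoisedTerm (ε / q) (q ^ 2) ρ⁻¹ k) :=
  Equiv.pnatEquivNat.symm.hasSum_iff.1 <|
    (hasSum_veryWellPoisedTerm_div hq0 hq hε (norm_inv_lt_one_of_one_lt_norm hρ)).congr_fun fun n =>
      (veryWellPoisedTerm_div_inv hq0 hε (norm_pos_iff.1 (one_pos.trans hρ)) n).symm

theorem hasSum_wellPoised_inv (hq0 : q ≠ 0) (hq : ‖q‖ < 1) (hε : ε ^ 2 = -1) (hρ : 1 < ‖ρ‖) :
    HasSum (fun n : ℕ+ =>
      (qPoch (-ε * ρ * q) (q ^ 2) n * (-1) ^ (n : ℕ)) /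
        (qPoch (ε * q / ρ) (q ^ 2) n * (1 - q ^ (2 * (n : ℕ))) * ρ ^ (n : ℕ)))
      (lambertSum ε q + ∑' k, veryWellPoisedTerm (ε / q) (q ^ 2) ρ⁻¹ k) :=
  Equiv.pnatEquivNat.symm.hasSum_iff.1 <|
    (hasSum_wellPoisedTerm_div hq0 hq hε (norm_inv_lt_one_of_one_lt_norm hρ)).congr_fun fun n =>
      (wellPoisedTerm_div_inv hq0 hε (norm_pos_iff.1 (one_pos.trans hρ)) n).symm

theorem hasSum_veryWellPoised_zero (hq0 : q ≠ 0) (hq : ‖q‖ < 1) (hε : ε ^ 2 = -1) :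
    HasSum (fun n : ℕ+ =>
      ((1 - ε * q ^ (4 * (n : ℕ) - 1)) * qPoch (ε / q) (q ^ 2) n *
          qPoch (q ^ 2) (q ^ 2) (2 * (n : ℕ) - 1) * q ^ ((n : ℕ) ^ 2 - (n : ℕ))) /
        ((1 - ε / q) * qPoch (q ^ 2) (q ^ 2) n * qPoch (-1) (q ^ 2) (2 * (n : ℕ))))
      (∑' k, veryWellPoisedTerm (ε / q) (q ^ 2) 0 k) :=
  Equiv.pnatEquivNat.symm.hasSum_iff.1 <|
    (hasSum_veryWellPoisedTerm_div hq0 hq hε (by simp)).congr_fun fun n =>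
      (veryWellPoisedTerm_div_zero hq0 hε n).symm

theorem hasSum_wellPoised_zero_odd (hq0 : q ≠ 0) (hq : ‖q‖ < 1) (hε : ε ^ 2 = -1) :
    HasSum (fun n : ℕ => ((-1) ^ n * q ^ (4 * n ^ 2 + 4 * n)) / (1 - q ^ (4 * n + 2)))
      ((lambertSum (-ε) q + ∑' k, veryWellPoisedTerm (-ε / q) (q ^ 2) 0 k -
        (lambertSum ε q + ∑' k, veryWellPoisedTerm (ε / q) (q ^ 2) 0 k)) / (2 * ε * q)) := by
  have hε' : (-ε) ^ 2 = -1 := by rwa [neg_sq]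
  have hε0 : ε ≠ 0 := by rintro rfl; norm_num at hε
  have hsub := (hasSum_wellPoisedTerm_div hq0 hq hε' (x := 0) (by simp)).sub
    (hasSum_wellPoisedTerm_div hq0 hq hε (x := 0) (by simp))
  have hodd (k : ℕ) (hk : k ∉ Set.range (2 * · : ℕ → ℕ)) :
      wellPoisedTerm (-ε / q) (q ^ 2) 0 k - wellPoisedTerm (ε / q) (q ^ 2) 0 k = 0 := by
    have hk : Even (k + 1) := by
      rw [Nat.even_add_one]
      rintro ⟨m, rfl⟩
      exact hk ⟨m, two_mul m⟩
    rw [wellPoisedTerm_div_zero hq0 hε', wellPoisedTerm_div_zero hq0 hε, neg_neg, neg_mul,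
      hk.neg_pow, sub_self]
  refine (((mul_right_injective₀ two_ne_zero).hasSum_iff hodd).2 hsub).div_const (2 * ε * q)
    |>.congr_fun fun n => ?_
  rw [Function.comp_apply, wellPoisedTerm_div_zero_sub hq0 hε, mul_div_cancel_left₀]
  exact mul_ne_zero (mul_ne_zero two_ne_zero hε0) hq0

end specialization

open Complex in
theorem corollary5 (q ρ₁ : ℂ) (hq0 : 0 < ‖q‖) (hq1 : ‖q‖ < 1) (hρ₁ : 1 < ‖ρ₁‖) :
    (∃ A₁ A₂ : ℂ,
      HasSum (fun n : ℕ+ =>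
        ((1 + I * q ^ (4 * (n : ℕ) - 1)) * (qPoch (-I / q) (q ^ 2) n * qPoch (-I / q) (q ^ 2) n) *
            qPoch (q ^ 2) (q ^ 2) (2 * (n : ℕ) - 1) * (-I * q) ^ (n : ℕ)) /
          ((1 + I / q) * (qPoch (q ^ 2) (q ^ 2) n * qPoch (q ^ 2) (q ^ 2) n) *
            qPoch (-1) (q ^ 2) (2 * (n : ℕ)))) A₁ ∧
      HasSum (fun n : ℕ+ =>
        ((1 - I * q ^ (4 * (n : ℕ) - 1)) * (qPoch (I / q) (q ^ 2) n * qPoch (I / q) (q ^ 2) n) *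
            qPoch (q ^ 2) (q ^ 2) (2 * (n : ℕ) - 1) * (I * q) ^ (n : ℕ)) /
          ((1 - I / q) * (qPoch (q ^ 2) (q ^ 2) n * qPoch (q ^ 2) (q ^ 2) n) *
            qPoch (-1) (q ^ 2) (2 * (n : ℕ)))) A₂ ∧
      ramanujanPsi (q ^ 4) ^ 2 = I / (2 * q) * (A₁ - A₂)) ∧
    (∃ B₁ B₂ B₃ B₄ : ℂ,
      HasSum (fun n : ℕ+ =>
        (qPoch (I * ρ₁ * q) (q ^ 2) n * (-1) ^ (n : ℕ)) /
          (qPoch (-I * q / ρ₁) (q ^ 2) n * (1 - q ^ (2 * (n : ℕ))) * ρ₁ ^ (n : ℕ))) B₁ ∧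
      HasSum (fun n : ℕ+ =>
        (qPoch (-I * ρ₁ * q) (q ^ 2) n * (-1) ^ (n : ℕ)) /
          (qPoch (I * q / ρ₁) (q ^ 2) n * (1 - q ^ (2 * (n : ℕ))) * ρ₁ ^ (n : ℕ))) B₂ ∧
      HasSum (fun n : ℕ+ =>
        ((1 - I * q ^ (4 * (n : ℕ) - 1)) * (qPoch (I / q) (q ^ 2) n * qPoch ρ₁ (q ^ 2) n) *
            qPoch (q ^ 2) (q ^ 2) (2 * (n : ℕ) - 1) * (-1) ^ (n : ℕ)) /
          ((1 - I / q) * (qPoch (I * q / ρ₁) (q ^ 2) n * qPoch (q ^ 2) (q ^ 2) n) *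
            qPoch (-1) (q ^ 2) (2 * (n : ℕ)) * ρ₁ ^ (n : ℕ))) B₃ ∧
      HasSum (fun n : ℕ+ =>
        ((1 + I * q ^ (4 * (n : ℕ) - 1)) * (qPoch (-I / q) (q ^ 2) n * qPoch ρ₁ (q ^ 2) n) *
            qPoch (q ^ 2) (q ^ 2) (2 * (n : ℕ) - 1) * (-1) ^ (n : ℕ)) /
          ((1 + I / q) * (qPoch (-I * q / ρ₁) (q ^ 2) n * qPoch (q ^ 2) (q ^ 2) n) *
            qPoch (-1) (q ^ 2) (2 * (n : ℕ)) * ρ₁ ^ (n : ℕ))) B₄ ∧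
      ramanujanPsi (q ^ 4) ^ 2 = 1 / (2 * I * q) * (B₁ - B₂ + B₃ - B₄)) ∧
    (∃ C₀ C₁ C₂ : ℂ,
      HasSum (fun n : ℕ =>
        ((-1) ^ n * q ^ (4 * n ^ 2 + 4 * n)) / (1 - q ^ (4 * n + 2))) C₀ ∧
      HasSum (fun n : ℕ+ =>
        ((1 - I * q ^ (4 * (n : ℕ) - 1)) * qPoch (I / q) (q ^ 2) n *
            qPoch (q ^ 2) (q ^ 2) (2 * (n : ℕ) - 1) * q ^ ((n : ℕ) ^ 2 - (n : ℕ))) /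
          ((1 - I / q) * qPoch (q ^ 2) (q ^ 2) n * qPoch (-1) (q ^ 2) (2 * (n : ℕ)))) C₁ ∧
      HasSum (fun n : ℕ+ =>
        ((1 + I * q ^ (4 * (n : ℕ) - 1)) * qPoch (-I / q) (q ^ 2) n *
            qPoch (q ^ 2) (q ^ 2) (2 * (n : ℕ) - 1) * q ^ ((n : ℕ) ^ 2 - (n : ℕ))) /
          ((1 + I / q) * qPoch (q ^ 2) (q ^ 2) n * qPoch (-1) (q ^ 2) (2 * (n : ℕ)))) C₂ ∧
      ramanujanPsi (q ^ 4) ^ 2 = C₀ + 1 / (2 * I * q) * (C₁ - C₂)) := by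
  have hq : q ≠ 0 := norm_pos_iff.1 hq0
  have hneg : (-I) ^ 2 = -1 := by rw [neg_sq, I_sq]
  have hIq : 2 * I * q ≠ 0 := mul_ne_zero (mul_ne_zero two_ne_zero I_ne_zero) hq
  have hpsi : ramanujanPsi (q ^ 4) ^ 2 = (lambertSum (-I) q - lambertSum I q) / (2 * I * q) := by
    rw [lambertSum_neg_sub hq hq1 I_sq, mul_div_cancel_left₀ _ hIq]
  refine ⟨⟨-lambertSum (-I) q, _, ?_, hasSum_veryWellPoised_self hq hq1 I_sq, ?_⟩,
    ⟨lambertSum (-I) q + ∑' k, veryWellPoisedTerm (-I / q) (q ^ 2) ρ₁⁻¹ k, _, _,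
      ∑' k, veryWellPoisedTerm (-I / q) (q ^ 2) ρ₁⁻¹ k, ?_, hasSum_wellPoised_inv hq hq1 I_sq hρ₁,
      hasSum_veryWellPoised_inv hq hq1 I_sq hρ₁, ?_, ?_⟩,
    ⟨_, _, ∑' k, veryWellPoisedTerm (-I / q) (q ^ 2) 0 k, hasSum_wellPoised_zero_odd hq hq1 I_sq,
      hasSum_veryWellPoised_zero hq hq1 I_sq, ?_, ?_⟩⟩
  · simpa only [neg_mul, neg_div, sub_neg_eq_add] using hasSum_veryWellPoised_self hq hq1 hneg
  · rw [hpsi]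
    field_simp
    rw [I_sq]
    ring
  · simpa only [neg_neg] using hasSum_wellPoised_inv hq hq1 hneg hρ₁
  · simpa only [neg_mul, neg_div, sub_neg_eq_add] using hasSum_veryWellPoised_inv hq hq1 hneg hρ₁
  · rw [hpsi]
    ring
  · simpa only [neg_mul, neg_div, sub_neg_eq_add] using hasSum_veryWellPoised_zero hq hq1 hneg
  · rw [hpsi]
    ring
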